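/- Let $\mathbf t=(t_1,t_2,t_3,\dots)$, and put $\xi(\mathbf t,z)=\sum_{k\ge1}t_kz^k$, $[z^{-1}]=(z^{-1},z^{-2}/2,z^{-3}/3,\dots)$ and ${\rm Res}_z\sum_i a_iz^i=a_{-1}$. Functions of $\mathbf t$ are formal power series in $t_1,t_2,\dots$ with complex coefficients. For every $n\in\mathbb Z$ let $$\Psi^{+}(n,\mathbf t,z)=\Big(\sum_{j\ge0}w_j^{+}(n,\mathbf t)z^{-j}\Big)e^{\xi(\mathbf t,z)}z^{n},\qquad \Psi^{-}(n,\mathbf t,z)=\Big(\sum_{j\ge0}w_j^{-}(n,\mathbf t)z^{-j}\Big)e^{-\xi(\mathbf t,z)}z^{-n-1}$$ with $w_j^{\pm}(n,\mathbf t)\in\mathbb C[[t_1,t_2,\dots]]$, and suppose that, for all $n',n''\in\mathbb Z$ and with independent sets of variables $\mathbf t',\mathbf t''$, $${\rm Res}_z\,z^{-1}\Big(\Psi^+(n',\mathbf t',z)\Psi^-(n'',\mathbf t'',z)+\Psi^-(n',\mathbf t',z)\Psi^+(n'',\mathbf t'',z)\Big)=\tfrac12\big(1-(-1)^{n'-n''}\big).$$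 Then there are power series $\tau_n(\mathbf t)\in\mathbb C[[t_1,t_2,\dots]]$, $n\in\mathbb Z$, with nonzero constant terms, such that $(\tau_n)_{n\in\mathbb Z}$ is a tau function of the large BKP hierarchy, that is, for all $n',n''\in\mathbb Z$, $${\rm Res}_z\Big(z^{n'-n''-2}\tau_{n'-1}(\mathbf t'-[z^{-1}])\tau_{n''+1}(\mathbf t''+[z^{-1}])e^{\xi(\mathbf t'-\mathbf t'',z)}+z^{n''-n'-2}\tau_{n'+1}(\mathbf t'+[z^{-1}])\tau_{n''-1}(\mathbf t''-[z^{-1}])e^{-\xi(\mathbf t'-\mathbf t'',z)}\Big)=\tfrac12\big(1-(-1)^{n'+n''}\big)\tau_{n'}(\mathbf t')\tau_{n''}(\mathbf t''),$$ and for all $n\in\mathbb Z$ $$\Psi^{+}(n,\mathbf t,z)=\frac{\tau_{n-1}(\mathbf t-[z^{-1}])}{\tau_n(\mathbf t)}e^{\xi(\mathbf t,z)}z^{n},\qquad \Psi^{-}(n,\mathbf t,z)=\frac{\tau_{n+1}(\mathbf t+[z^{-1}])}{\tau_n(\mathbf t)}e^{-\xi(\mathbf t,z)}z^{-n-1}.$$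 -/

import Mathlib

noncomputable section

namespace LargeBKP

/-- Formal power series over `ℂ` in the variables `x_i`, `i : σ`.  With `σ = ℕ+` these are the
formal functions `f(t)` of the times `t = (t₁, t₂, t₃, …)`; with `σ = ℕ+ ⊕ ℕ+` the formal functions
of two independent sets of times `(t', t'')`. -/
abbrev Fun (σ : Type) : Type := MvPowerSeries σ ℂ

/-- Two-sided formal series `∑_{k ∈ ℤ} A_k z^k`, `A k` being the coefficient of `z^k`. -/
abbrev ZSeries (σ : Type) : Type := ℤ → Fun σ

/-- `∑_{j ≥ 0} a_j z^{-j}` as a two-sided series; the power series variable stands for `z⁻¹`. -/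
def ofInvZ {σ : Type} (A : PowerSeries (Fun σ)) : ZSeries σ :=
  fun k => if k ≤ 0 then PowerSeries.coeff (-k).toNat A else 0

/-- `∑_{j ≥ 0} a_j z^j` as a two-sided series; the power series variable stands for `z`. -/
def ofZ {σ : Type} (A : PowerSeries (Fun σ)) : ZSeries σ :=
  fun k => if 0 ≤ k then PowerSeries.coeff k.toNat A else 0

/-- Multiplication by `z^m`. -/
def zMul {σ : Type} (m : ℤ) (A : ZSeries σ) : ZSeries σ := fun k => A (k - m)

/-- The Cauchy product of two-sided series: the coefficient of `z^k` is `∑_{a ∈ ℤ} A_a B_{k-a}`, the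
sum being formed separately for each monomial in the variables `x_i`.  In all the products below
only finitely many `a` contribute to a given monomial. -/
def mulZ {σ : Type} (A B : ZSeries σ) : ZSeries σ :=
  fun k d => ∑ᶠ a : ℤ, MvPowerSeries.coeff d (A a * B (k - a))

/-- `Res_z ∑ A_k z^k = A_{-1}`. -/
def resZ {σ : Type} (A : ZSeries σ) : Fun σ := A (-1)

/-- `ξ(x, z) = ∑_{k ≥ 1} x_k z^k`, as a power series in `z`. -/
def xi {σ : Type} (x : ℕ+ → Fun σ) : PowerSeries (Fun σ) :=
  PowerSeries.mk fun k => match k with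
    | 0 => 0
    | j + 1 => x j.succPNat

/-- The series `ξ(x, z)` has no constant term in `z`, so it may be substituted into `exp`. -/
theorem xi_hasSubst {σ : Type} (x : ℕ+ → Fun σ) : PowerSeries.HasSubst (xi x) :=
  PowerSeries.HasSubst.of_constantCoeff_zero' (by
    rw [← PowerSeries.coeff_zero_eq_constantCoeff_apply]; simp [xi])

/-- `e^{ξ(x, z)}`, as a power series in `z`. -/
def expXi {σ : Type} (x : ℕ+ → Fun σ) : PowerSeries (Fun σ) :=
  (PowerSeries.exp ℂ).subst (xi x)

/-- The shifted argument `t + ε [z⁻¹]`, where `[z⁻¹] = (z⁻¹, z⁻²/2, z⁻³/3, …)`: its `k`-th entry is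
`t_k + ε z^{-k} / k`.  Here `X (some k)` is `t_k` and `X none` is `z⁻¹`. -/
def miwaArg (ε : ℂ) (k : ℕ+) : MvPowerSeries (Option ℕ+) ℂ :=
  MvPowerSeries.X (some k) +
    MvPowerSeries.C (ε / ((k : ℕ) : ℂ)) * (MvPowerSeries.X none) ^ (k : ℕ)

/-- The substitution `t ↦ t + ε [z⁻¹]` is defined on all formal power series. -/
theorem miwaArg_hasSubst (ε : ℂ) : MvPowerSeries.HasSubst (miwaArg ε) where
  const_coeff k := by
    have h : MvPowerSeries.constantCoeff (miwaArg ε k) = 0 := by simp [miwaArg]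
    rw [h]; exact IsNilpotent.zero
  coeff_zero d := by
    classical
    have hX : {k : ℕ+ | d = Finsupp.single (some k) 1}.Finite :=
      Set.Subsingleton.finite fun a ha b hb => by
        have h := (Set.mem_ofPred.mp ha).symm.trans (Set.mem_ofPred.mp hb)
        simpa using (Finsupp.single_left_inj one_ne_zero).mp h
    have hU : {k : ℕ+ | d = Finsupp.single none (k : ℕ)}.Finite :=
      Set.Subsingleton.finite fun a ha b hb => by
        have h := (Set.mem_ofPred.mp ha).symm.trans (Set.mem_ofPred.mp hb)
        exact PNat.coe_injective (by simpa using DFunLike.congr_fun h none)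
    refine (hX.union hU).subset fun k hk => ?_
    by_contra h
    simp only [Set.mem_union, Set.mem_ofPred_eq, not_or] at h
    apply hk
    simp [miwaArg, MvPowerSeries.coeff_X, MvPowerSeries.coeff_X_pow, MvPowerSeries.coeff_C_mul, h.1, h.2]

/-- `f(t + ε [z⁻¹])`, as a power series in `z⁻¹` whose coefficients are functions of `t`. -/
def miwa (ε : ℂ) (f : Fun ℕ+) : PowerSeries (Fun ℕ+) :=
  MvPowerSeries.optionEquivLeft ℕ+ ℂ (MvPowerSeries.subst (miwaArg ε) f)

/-- The times `t_k` (one set of times). -/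
def t (k : ℕ+) : Fun ℕ+ := MvPowerSeries.X k

/-- The times `t'_k` (the first of two sets of times). -/
def t₁ (k : ℕ+) : Fun (ℕ+ ⊕ ℕ+) := MvPowerSeries.X (Sum.inl k)

/-- The times `t''_k` (the second of two sets of times). -/
def t₂ (k : ℕ+) : Fun (ℕ+ ⊕ ℕ+) := MvPowerSeries.X (Sum.inr k)

/-- `f(t) ↦ f(t')`. -/
def at₁ : Fun ℕ+ →ₐ[ℂ] Fun (ℕ+ ⊕ ℕ+) :=
  MvPowerSeries.rename (Function.Embedding.inl : ℕ+ ↪ ℕ+ ⊕ ℕ+)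

/-- `f(t) ↦ f(t'')`. -/
def at₂ : Fun ℕ+ →ₐ[ℂ] Fun (ℕ+ ⊕ ℕ+) :=
  MvPowerSeries.rename (Function.Embedding.inr : ℕ+ ↪ ℕ+ ⊕ ℕ+)

/-- `A(z) e^{ξ(t, z)} z^n` for `A(z) = ∑_{j ≥ 0} a_j(t) z^{-j}`. -/
def plusForm (n : ℤ) (A : PowerSeries (Fun ℕ+)) : ZSeries ℕ+ :=
  zMul n (mulZ (ofInvZ A) (ofZ (expXi t)))

/-- `A(z) e^{-ξ(t, z)} z^{-n-1}` for `A(z) = ∑_{j ≥ 0} a_j(t) z^{-j}`. -/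
def minusForm (n : ℤ) (A : PowerSeries (Fun ℕ+)) : ZSeries ℕ+ :=
  zMul (-n - 1) (mulZ (ofInvZ A) (ofZ (expXi (-t))))

/-- The bilinear identity for the wave functions,
`Res_z z⁻¹ (Ψ⁺(n',t',z) Ψ⁻(n'',t'',z) + Ψ⁻(n',t',z) Ψ⁺(n'',t'',z)) = (1 - (-1)^{n'-n''}) / 2`
for all integers `n', n''`, with independent `t', t''`. -/
def WaveBilinear (Ψp Ψm : ℤ → ZSeries ℕ+) : Prop :=
  ∀ n' n'' : ℤ,
    resZ (zMul (-1)
      (mulZ (fun k => at₁ (Ψp n' k)) (fun k => at₂ (Ψm n'' k)) +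
        mulZ (fun k => at₁ (Ψm n' k)) (fun k => at₂ (Ψp n'' k)))) =
      MvPowerSeries.C ((1 - (-1 : ℂ) ^ (n' - n'')) / 2)

/-- `(τ_n)_{n ∈ ℤ}` is a tau function of the large BKP hierarchy:
`Res_z ( z^{n'-n''-2} τ_{n'-1}(t'-[z⁻¹]) τ_{n''+1}(t''+[z⁻¹]) e^{ξ(t'-t'',z)}`
`+ z^{n''-n'-2} τ_{n'+1}(t'+[z⁻¹]) τ_{n''-1}(t''-[z⁻¹]) e^{-ξ(t'-t'',z)} )`
`= (1 - (-1)^{n'+n''}) / 2 · τ_{n'}(t') τ_{n''}(t'')` for all integers `n', n''`. -/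
def IsTauFunction (τ : ℤ → Fun ℕ+) : Prop :=
  ∀ n' n'' : ℤ,
    resZ
      (zMul (n' - n'' - 2)
          (mulZ
            (ofInvZ (PowerSeries.map at₁.toRingHom (miwa (-1) (τ (n' - 1))) *
              PowerSeries.map at₂.toRingHom (miwa 1 (τ (n'' + 1)))))
            (ofZ (expXi (t₁ - t₂)))) +
        zMul (n'' - n' - 2)
          (mulZ
            (ofInvZ (PowerSeries.map at₁.toRingHom (miwa 1 (τ (n' + 1))) *
              PowerSeries.map at₂.toRingHom (miwa (-1) (τ (n'' - 1)))))
            (ofZ (expXi (-(t₁ - t₂)))))) =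
      MvPowerSeries.C ((1 - (-1 : ℂ) ^ (n' + n'')) / 2) * (at₁ (τ n') * at₂ (τ n''))

end LargeBKP

end

/-! Strip the exponentials and powers of `z` from the wave functions, leaving amplitudes `P_n(t,z)`
and `Q_n(t,z)`, series in `z⁻¹` with leading coefficients `p_n` and `q_n`. The wave identity becomes
a bilinear residue identity with kernels `e^{±ξ(t'-t'',z)}`. If `t' - t'' = [x] + [y]`, one kernel
is `1/((1-xz)(1-yz))`, whose residue evaluates the amplitudes at `z⁻¹ = x` and `z⁻¹ = y`; the other
is a quadratic polynomial in `z`, whose residue sees at most leading coefficients.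

Three choices of indices give everything that is needed. For `n' - n'' = 2`, `P_{n+1}(t',x)
Q_{n-1}(t'',x)` is unchanged when `x` becomes `y` (`AmplitudeBilinear.symmetric`). For `y = 0` and
difference `1`, `P_{n+1}(t,x) Q_n(t-[x],x) = 1` (`AmplitudeBilinear.mul_eq_one`). For `y = 0` and
difference `0`, `P_n(t,x) Q_n(t-[x],x) = q_n(t) p_n(t-[x])` (`AmplitudeBilinear.mul_eq_leading`).

The desired formulas force `τ_{n+1} = q_n τ_n` and `τ_n(t-[x]) = A_n(t,x) τ_n(t)` with `A_n = q_n
P_{n+1}`. The second equation requires the cocycle condition `A(t,x) A(t-[x],y) = A(t,y)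
A(t-[y],x)`, which follows from the three relations (`AmplitudeBilinear.commutation`). Conversely,
this condition with `A(t,0) = 1` suffices (`exists_shift_eq`): the derivation `N = ∂_u + ∑ u^i
∂_{t_{i+1}}` annihilates every `f(t-[u])`, so `log τ` must have partial derivatives equal to minus
the coefficients of `N A / A`. The cocycle condition makes this 1-form closed, hence exact over
formal power series; a solution of an equation in `N` is determined by its value at `u = 0`.

It is enough to solve for `τ_0` and propagate by `q_n`, since the relations carry the shift equation
from `n` to `n ± 1` (`AmplitudeBilinear.exists_tau`). The tau identity is then the wave identity
multiplied by `τ_{n'}(t') τ_{n''}(t'')`. -/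

section Lemmas

open MvPowerSeries

namespace LargeBKP

/-! ### Continuity of maps of power series, and extension of identities from polynomials -/

section FinDet

variable {σ τ υ : Type*} {R S T : Type*} [CommRing R] [CommRing S] [CommRing T]

/-- Every coefficient of `L f` depends on finitely many coefficients of `f` only. -/
def FinDet (L : MvPowerSeries σ R → MvPowerSeries τ S) : Prop :=
  ∀ e, ∃ D : Finset (σ →₀ ℕ), ∀ f g, (∀ d ∈ D, coeff d f = coeff d g) →
    coeff e (L f) = coeff e (L g)

theorem FinDet.const (g : MvPowerSeries τ S) :
    FinDet (fun _ : MvPowerSeries σ R => g) := fun _ => ⟨∅, fun _ _ _ => rfl⟩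

theorem FinDet.comp {L : MvPowerSeries τ S → MvPowerSeries υ T}
    {M : MvPowerSeries σ R → MvPowerSeries τ S} (hL : FinDet L) (hM : FinDet M) :
    FinDet (fun f => L (M f)) := by
  classical
  intro e
  obtain ⟨D, hD⟩ := hL e
  choose E hE using hM
  exact ⟨D.biUnion E, fun f g h => hD _ _ fun d hd => hE d _ _ fun x hx =>
    h x (Finset.mem_biUnion.mpr ⟨d, hd, hx⟩)⟩

theorem FinDet.add {L M : MvPowerSeries σ R → MvPowerSeries τ S} (hL : FinDet L) (hM : FinDet M) :
    FinDet (fun f => L f + M f) := by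
  classical
  intro e
  obtain ⟨D, hD⟩ := hL e
  obtain ⟨E, hE⟩ := hM e
  refine ⟨D ∪ E, fun f g h => ?_⟩
  rw [map_add, map_add, hD f g fun d hd => h d (Finset.mem_union_left _ hd),
    hE f g fun d hd => h d (Finset.mem_union_right _ hd)]

theorem FinDet.mul {L M : MvPowerSeries σ R → MvPowerSeries τ S} (hL : FinDet L) (hM : FinDet M) :
    FinDet (fun f => L f * M f) := by
  classical
  intro e
  choose D hD using hL
  choose E hE using hM
  refine ⟨(Finset.HasAntidiagonal.antidiagonal e).biUnion fun p => D p.1 ∪ E p.2, fun f g h => ?_⟩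
  rw [coeff_mul, coeff_mul]
  refine Finset.sum_congr rfl fun p hp => ?_
  rw [hD p.1 f g fun d hd => h d (Finset.mem_biUnion.mpr ⟨p, hp, Finset.mem_union_left _ hd⟩),
    hE p.2 f g fun d hd => h d (Finset.mem_biUnion.mpr ⟨p, hp, Finset.mem_union_right _ hd⟩)]

theorem FinDet.sub {L M : MvPowerSeries σ R → MvPowerSeries τ S} (hL : FinDet L) (hM : FinDet M) :
    FinDet (fun f => L f - M f) := by
  simpa [sub_eq_add_neg] using hL.add ((FinDet.const (-1)).mul hM)

theorem FinDet.subst [Algebra R S] {a : σ → MvPowerSeries τ S} (ha : HasSubst a) :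
    FinDet (fun f : MvPowerSeries σ R => MvPowerSeries.subst a f) := by
  intro e
  -- With every coefficient equal to `1`, the finiteness of substitution bounds the contributing
  -- exponents independently of the series being substituted into.
  obtain ⟨F, hF⟩ : ∃ F : MvPowerSeries σ S, ∀ d, coeff d F = 1 := ⟨fun _ => 1, fun _ => rfl⟩
  have hfin : (Function.support _).Finite := coeff_subst_finite (R := S) ha F e
  refine ⟨hfin.toFinset, fun f g h => ?_⟩
  rw [coeff_subst ha, coeff_subst ha]
  refine finsum_congr fun d => ?_
  by_cases hd : coeff e (d.prod fun s e => (a s) ^ e) = 0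
  · simp [hd]
  · rw [h d]
    simpa [hF] using hd

theorem FinDet.pderiv (s : σ) :
    FinDet (fun f : MvPowerSeries σ R => MvPowerSeries.pderiv R s f) := fun e =>
  ⟨{e + Finsupp.single s 1}, fun f g h => by simp [coeff_pderiv, h]⟩

/-- Truncating `f` to the finitely many monomials that influence a given coefficient on either side
replaces it by a polynomial. This is the density argument behind all later identities between
substitutions. -/
theorem FinDet.ext_polynomial {L M : MvPowerSeries σ R → MvPowerSeries τ S} (hL : FinDet L)
    (hM : FinDet M) (h : ∀ p : MvPolynomial σ R, L p = M p) (f : MvPowerSeries σ R) :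
    L f = M f := by
  classical
  ext e
  obtain ⟨D, hD⟩ := hL e
  obtain ⟨E, hE⟩ := hM e
  let p : MvPolynomial σ R := ∑ d ∈ D ∪ E, MvPolynomial.monomial d (coeff d f)
  have hp : ∀ d ∈ D ∪ E, coeff d f = coeff d (p : MvPowerSeries σ R) := by
    intro d hd
    have hd' : d ∈ D ∨ d ∈ E := by simpa using hd
    simp [p, MvPolynomial.coeff_sum, MvPolynomial.coeff_monomial, hd']
  rw [hD f p fun d hd => hp d (Finset.mem_union_left _ hd), h,
    hE f p fun d hd => hp d (Finset.mem_union_right _ hd)]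

theorem FinDet.ext_algHom {L M : MvPowerSeries σ R →ₐ[R] MvPowerSeries τ R} (hL : FinDet L)
    (hM : FinDet M) (h : ∀ s, L (X s) = M (X s)) : L = M := by
  refine AlgHom.ext (hL.ext_polynomial hM fun p => ?_)
  have : L.comp (MvPolynomial.coeToMvPowerSeries.algHom (R := R) R) =
      M.comp (MvPolynomial.coeToMvPowerSeries.algHom (R := R) R) := by
    refine MvPolynomial.algHom_ext fun s => ?_
    simpa using h s
  simpa using DFunLike.congr_fun this p

theorem FinDet.ext_monomial {L M : MvPowerSeries σ R →+ MvPowerSeries τ S} (hL : FinDet L)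
    (hM : FinDet M) (h : ∀ d r, L (monomial d r) = M (monomial d r)) : L = M := by
  refine AddMonoidHom.ext (hL.ext_polynomial hM fun p => ?_)
  induction p using MvPolynomial.induction_on' with
  | monomial d r => simpa using h d r
  | add p q hp hq => simp [hp, hq]

end FinDet

/-- The chain rule: both sides are additive and continuous in `g`, so monomials suffice, and there
it is the power rule. -/
theorem pderiv_subst {τ R : Type*} [CommRing R] {a : MvPowerSeries τ R}
    (ha : PowerSeries.HasSubst a) (s : τ) (g : PowerSeries R) :
    pderiv R s (g.subst a) = (PowerSeries.derivative R g).subst a * pderiv R s a := by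
  let L : PowerSeries R →+ MvPowerSeries τ R :=
    (pderiv R s).toLinearMap.toAddMonoidHom.comp
      (PowerSeries.substAlgHom (R := R) ha).toRingHom.toAddMonoidHom
  let M : PowerSeries R →+ MvPowerSeries τ R :=
    (AddMonoidHom.mulRight (pderiv R s a)).comp
      ((PowerSeries.substAlgHom (R := R) ha).toRingHom.toAddMonoidHom.comp
        (PowerSeries.derivative R).toLinearMap.toAddMonoidHom)
  have hs : FinDet (fun f : PowerSeries R => PowerSeries.substAlgHom (R := R) ha f) := by
    rw [PowerSeries.coe_substAlgHom]
    exact FinDet.subst ha.const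
  have hLM : L = M := by
    refine FinDet.ext_monomial ?_ ?_ fun d r => ?_
    · exact (FinDet.pderiv s).comp hs
    · exact (hs.comp (FinDet.pderiv ())).mul (FinDet.const (pderiv R s a))
    · obtain ⟨n, rfl⟩ : ∃ n, d = Finsupp.single () n := ⟨d (), by ext; simp⟩
      change pderiv R s (PowerSeries.substAlgHom ha (PowerSeries.monomial n r)) =
        PowerSeries.substAlgHom ha (PowerSeries.derivative R (PowerSeries.monomial n r)) * _
      rw [PowerSeries.monomial_eq_C_mul_X_pow, ← PowerSeries.smul_eq_C_mul]
      simp [PowerSeries.substAlgHom_X, Derivation.leibniz_pow]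
      rw [mul_assoc]
  rw [← PowerSeries.coe_substAlgHom ha]
  exact DFunLike.congr_fun hLM g

/-! ### Products of two-sided series -/

section Regular

variable {σ : Type}

/-- Two-sided series in which, for each monomial in the variables, the powers of `z` are bounded
above. -/
def Regular (A : ZSeries σ) : Prop :=
  ∀ d, ∃ N : ℤ, ∀ k, N < k → coeff d (A k) = 0

/-- The two-sided series of a power series over the Laurent series in `z⁻¹`. -/
noncomputable def ofLaurent (F : MvPowerSeries σ (LaurentSeries ℂ)) : ZSeries σ :=
  fun k d => (coeff d F).coeff (-k)

theorem coeff_ofLaurent (F : MvPowerSeries σ (LaurentSeries ℂ)) (k : ℤ) (d : σ →₀ ℕ) :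
    coeff d (ofLaurent F k) = (coeff d F).coeff (-k) := rfl

/-- Powers of `z` bounded above are powers of `z⁻¹` bounded below; the Laurent variable stands for
`z⁻¹`, whence the sign changes in the exponents. -/
theorem Regular.exists_ofLaurent {A : ZSeries σ} (hA : Regular A) : ∃ F, ofLaurent F = A := by
  choose N hN using hA
  let F : MvPowerSeries σ (LaurentSeries ℂ) := fun d =>
    HahnSeries.ofSuppBddBelow (fun k => coeff d (A (-k))) ⟨-N d, fun k hk => by
      by_contra h
      exact hk (hN d (-k) (by linarith [not_le.mp h]))⟩
  refine ⟨F, funext fun k => ext fun d => ?_⟩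
  change coeff d (A (- -k)) = _
  rw [neg_neg]

theorem coeff_mulZ (A B : ZSeries σ) (k : ℤ) (d : σ →₀ ℕ) :
    coeff d (mulZ A B k) = ∑ᶠ a : ℤ, coeff d (A a * B (k - a)) := rfl

theorem support_laurent_mul_finite (f g : LaurentSeries ℂ) (n : ℤ) :
    (Function.support fun a : ℤ => f.coeff a * g.coeff (n - a)).Finite := by
  refine (Set.finite_Icc f.order (n - g.order)).subset fun a ha => ⟨?_, ?_⟩
  · by_contra h
    exact ha (by simp [HahnSeries.coeff_eq_zero_of_lt_order (not_le.mp h)])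
  · by_contra h
    exact ha (by simp [HahnSeries.coeff_eq_zero_of_lt_order (x := g) (i := n - a) (by linarith)])

theorem laurent_coeff_mul (f g : LaurentSeries ℂ) (n : ℤ) :
    (f * g).coeff n = ∑ᶠ a : ℤ, f.coeff a * g.coeff (n - a) := by
  rw [HahnSeries.coeff_mul]
  rw [finsum_eq_sum_of_support_subset (s := (Finset.antidiagonal f.isPWO_support
    g.isPWO_support n).image Prod.fst) _ ?_, Finset.sum_image]
  · refine Finset.sum_congr rfl fun p hp => ?_
    rw [← (Finset.mem_antidiagonal.mp hp).2.2]
    simp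
  · intro p hp q hq h
    have h1 := (Finset.mem_antidiagonal.mp hp).2.2
    have h2 := (Finset.mem_antidiagonal.mp hq).2.2
    exact Prod.ext h (by linarith)
  · intro a ha
    exact Finset.mem_coe.mpr (Finset.mem_image.mpr ⟨(a, n - a), Finset.mem_antidiagonal.mpr
      ⟨left_ne_zero_of_mul ha, right_ne_zero_of_mul ha, by simp⟩, rfl⟩)

/-- This identifies regular two-sided series with a commutative ring. Associativity and
commutativity of the Cauchy product, which need not make sense for arbitrary two-sided series, are
inherited from it. -/
theorem mulZ_ofLaurent (F G : MvPowerSeries σ (LaurentSeries ℂ)) :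
    mulZ (ofLaurent F) (ofLaurent G) = ofLaurent (F * G) := by
  classical
  refine funext fun k => ext fun d => ?_
  rw [coeff_mulZ, coeff_ofLaurent, coeff_mul, HahnSeries.coeff_sum]
  simp_rw [coeff_mul, coeff_ofLaurent]
  rw [← finsum_comp_equiv (Equiv.neg ℤ)]
  simp only [Equiv.neg_apply, neg_neg]
  have h : ∀ a, -(k - -a) = -k - a := fun a => by ring
  simp_rw [h]
  rw [finsum_sum_comm _ _ fun p _ => support_laurent_mul_finite _ _ _]
  simp_rw [laurent_coeff_mul]

theorem mulZ_assoc {A B C : ZSeries σ} (hA : Regular A) (hB : Regular B) (hC : Regular C) :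
    LargeBKP.mulZ (LargeBKP.mulZ A B) C = LargeBKP.mulZ A (LargeBKP.mulZ B C) := by
  obtain ⟨F, rfl⟩ := hA.exists_ofLaurent
  obtain ⟨G, rfl⟩ := hB.exists_ofLaurent
  obtain ⟨H, rfl⟩ := hC.exists_ofLaurent
  simp_rw [mulZ_ofLaurent, mul_assoc]

theorem mulZ_mulZ_mulZ_comm {A B C D : ZSeries σ} (hA : Regular A) (hB : Regular B)
    (hC : Regular C) (hD : Regular D) :
    LargeBKP.mulZ (LargeBKP.mulZ A B) (LargeBKP.mulZ C D) =
      LargeBKP.mulZ (LargeBKP.mulZ A C) (LargeBKP.mulZ B D) := by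
  obtain ⟨F, rfl⟩ := hA.exists_ofLaurent
  obtain ⟨G, rfl⟩ := hB.exists_ofLaurent
  obtain ⟨H, rfl⟩ := hC.exists_ofLaurent
  obtain ⟨K, rfl⟩ := hD.exists_ofLaurent
  simp_rw [mulZ_ofLaurent, mul_mul_mul_comm]

theorem zMul_zMul (m n : ℤ) (A : ZSeries σ) : zMul m (zMul n A) = zMul (m + n) A :=
  funext fun k => by simp only [LargeBKP.zMul]; congr 1; ring

theorem zMul_add (m : ℤ) (A B : ZSeries σ) : zMul m (A + B) = zMul m A + zMul m B := rfl

theorem mulZ_zMul_zMul (m n : ℤ) (A B : ZSeries σ) :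
    LargeBKP.mulZ (LargeBKP.zMul m A) (LargeBKP.zMul n B) =
      LargeBKP.zMul (m + n) (LargeBKP.mulZ A B) := by
  refine funext fun k => ext fun d => ?_
  simp only [LargeBKP.zMul]
  rw [coeff_mulZ, coeff_mulZ, ← finsum_comp_equiv (Equiv.addRight m)]
  refine finsum_congr fun a => ?_
  simp only [Equiv.coe_addRight]
  change coeff d (A (a + m - m) * B (k - (a + m) - n)) = _
  rw [show a + m - m = a by ring, show k - (a + m) - n = k - (m + n) - a by ring]

theorem regular_ofInvZ (A : PowerSeries (Fun σ)) : Regular (ofInvZ A) := fun d =>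
  ⟨0, fun k hk => by simp [ofInvZ, not_le.mpr hk]⟩

theorem mulZ_ofInvZ (A B : PowerSeries (Fun σ)) :
    mulZ (ofInvZ A) (ofInvZ B) = ofInvZ (A * B) := by
  classical
  refine funext fun k => ext fun d => ?_
  rw [coeff_mulZ]
  by_cases hk : k ≤ 0
  · obtain ⟨n, rfl⟩ : ∃ n : ℕ, k = -n := ⟨(-k).toNat, by omega⟩
    simp only [ofInvZ, hk, if_true, neg_neg, Int.toNat_natCast, PowerSeries.coeff_mul, map_sum]
    rw [finsum_eq_sum_of_support_subset (s := (Finset.HasAntidiagonal.antidiagonal n).image fun p => (-(p.1 : ℤ)))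
      _ ?_, Finset.sum_image]
    · refine Finset.sum_congr rfl fun p hp => ?_
      have := Finset.HasAntidiagonal.mem_antidiagonal.mp hp
      rw [if_pos (by omega), if_pos (by omega)]
      congr 4 <;> omega
    · intro p hp q hq h
      have h1 := Finset.HasAntidiagonal.mem_antidiagonal.mp hp
      have h2 := Finset.HasAntidiagonal.mem_antidiagonal.mp hq
      simp only at h
      exact Prod.ext (by omega) (by omega)
    · intro a ha
      have h1 : a ≤ 0 := by by_contra h; exact ha (by simp [h])
      have h2 : -(n : ℤ) - a ≤ 0 := by by_contra h; exact ha (by simp only [if_neg h]; simp)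
      simp only [Finset.coe_image, Set.mem_image, Finset.mem_coe, Finset.HasAntidiagonal.mem_antidiagonal]
      exact ⟨((-a).toNat, (n + a).toNat), by simp only; omega, by simp only; omega⟩
  · simp only [ofInvZ, hk, if_false]
    refine finsum_eq_zero_of_forall_eq_zero fun a => ?_
    by_cases h1 : a ≤ 0
    · rw [if_neg (show ¬ (k - a ≤ 0) by omega)]; simp
    · simp [h1]

theorem mulZ_ofZ (A B : PowerSeries (Fun σ)) :
    mulZ (ofZ A) (ofZ B) = ofZ (A * B) := by
  classical
  refine funext fun k => ext fun d => ?_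
  rw [coeff_mulZ]
  by_cases hk : 0 ≤ k
  · obtain ⟨n, rfl⟩ : ∃ n : ℕ, k = n := ⟨k.toNat, by omega⟩
    simp only [ofZ, hk, if_true, Int.toNat_natCast, PowerSeries.coeff_mul, map_sum]
    rw [finsum_eq_sum_of_support_subset (s := (Finset.HasAntidiagonal.antidiagonal n).image fun p => ((p.1 : ℤ)))
      _ ?_, Finset.sum_image]
    · refine Finset.sum_congr rfl fun p hp => ?_
      have := Finset.HasAntidiagonal.mem_antidiagonal.mp hp
      rw [if_pos (by omega), if_pos (by omega)]
      congr 4; omega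
    · intro p hp q hq h
      have h1 := Finset.HasAntidiagonal.mem_antidiagonal.mp hp
      have h2 := Finset.HasAntidiagonal.mem_antidiagonal.mp hq
      simp only at h
      exact Prod.ext (by omega) (by omega)
    · intro a ha
      have h1 : 0 ≤ a := by by_contra h; exact ha (by simp [h])
      have h2 : 0 ≤ (n : ℤ) - a := by by_contra h; exact ha (by simp only [if_neg h]; simp)
      simp only [Finset.coe_image, Set.mem_image, Finset.mem_coe, Finset.HasAntidiagonal.mem_antidiagonal]
      exact ⟨(a.toNat, (n - a).toNat), by simp only; omega, by simp only; omega⟩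
  · simp only [ofZ, hk, if_false]
    refine finsum_eq_zero_of_forall_eq_zero fun a => ?_
    by_cases h1 : 0 ≤ a
    · rw [if_neg (show ¬ (0 ≤ k - a) by omega)]; simp
    · simp [h1]

theorem mulZ_ofInvZ_C (c : Fun σ) (A : ZSeries σ) (k : ℤ) :
    mulZ (ofInvZ (PowerSeries.C c)) A k = c * A k := by
  ext d
  rw [coeff_mulZ, finsum_eq_single _ 0]
  · simp [ofInvZ]
  · intro a ha
    by_cases h : a ≤ 0
    · simp [ofInvZ, h, PowerSeries.coeff_C, show (-a).toNat ≠ 0 by omega]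
    · simp [ofInvZ, h]

end Regular

/-- Renaming variables injectively commutes with the product of two-sided series. -/
theorem rename_mulZ {σ τ : Type} (e : σ ↪ τ) (A B : ZSeries σ) :
    (fun k => rename e (mulZ A B k)) = mulZ (fun k => rename e (A k)) (fun k => rename e (B k)) := by
  refine funext fun k => ext fun d => ?_
  rw [coeff_mulZ]
  simp_rw [← map_mul]
  by_cases hd : d ∈ Set.range (Finsupp.mapDomain e)
  · obtain ⟨c, rfl⟩ := hd
    simp_rw [← Finsupp.embDomain_eq_mapDomain, coeff_embDomain_rename]
    rfl
  · simp_rw [coeff_rename_eq_zero _ _ hd]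
    simp

/-! ### The exponential kernel and its weights -/

section ExpXi

variable {σ τ : Type}

theorem coeff_zero_xi (x : ℕ+ → Fun σ) : PowerSeries.coeff 0 (xi x) = 0 := by simp [xi]

theorem coeff_succ_xi (x : ℕ+ → Fun σ) (n : ℕ) :
    PowerSeries.coeff (n + 1) (xi x) = x n.succPNat := by simp [xi]

theorem constantCoeff_xi (x : ℕ+ → Fun σ) : PowerSeries.constantCoeff (xi x) = 0 := by
  rw [← PowerSeries.coeff_zero_eq_constantCoeff_apply, coeff_zero_xi]

theorem xi_add (x y : ℕ+ → Fun σ) : xi (x + y) = xi x + xi y := by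
  ext1 n
  cases n <;> simp [constantCoeff_xi, coeff_succ_xi]

theorem xi_neg (x : ℕ+ → Fun σ) : xi (-x) = -xi x := by
  ext1 n
  cases n <;> simp [constantCoeff_xi, coeff_succ_xi]

theorem coeff_expXi (x : ℕ+ → Fun σ) (k : ℕ) :
    PowerSeries.coeff k (expXi x) =
      ∑ᶠ n : ℕ, PowerSeries.coeff n (PowerSeries.exp ℂ) • PowerSeries.coeff k (xi x ^ n) :=
  PowerSeries.coeff_subst' (xi_hasSubst x) _ k

theorem map_expXi (Φ : Fun σ →ₐ[ℂ] Fun τ) (x : ℕ+ → Fun σ) :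
    PowerSeries.map Φ.toRingHom (expXi x) = expXi (fun k => Φ (x k)) := by
  have hxi : PowerSeries.map Φ.toRingHom (xi x) = xi (fun k => Φ (x k)) := by
    ext1 n
    cases n <;> simp [constantCoeff_xi, coeff_succ_xi]
  ext1 k
  rw [PowerSeries.coeff_map, coeff_expXi, coeff_expXi]
  change (Φ.toLinearMap.toAddMonoidHom : Fun σ →+ Fun τ) _ = _
  rw [AddMonoidHom.map_finsum _ (PowerSeries.coeff_subst_finite' (xi_hasSubst x) _ k)]
  refine finsum_congr fun n => ?_
  rw [← hxi, ← map_pow, PowerSeries.coeff_map]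
  exact map_smul Φ _ _

/-- Moving the scalars of `exp` from `ℂ` to the coefficient ring makes the one-variable chain rule
in `z` applicable. -/
theorem expXi_eq_subst (x : ℕ+ → Fun σ) :
    expXi x = (PowerSeries.exp (Fun σ)).subst (xi x) := by
  ext1 k
  rw [coeff_expXi, PowerSeries.coeff_subst' (xi_hasSubst x)]
  refine finsum_congr fun n => ?_
  rw [PowerSeries.coeff_exp, PowerSeries.coeff_exp, IsScalarTower.algebraMap_apply ℚ ℂ (Fun σ),
    algebraMap_smul (Fun σ)]

theorem derivative_expXi (x : ℕ+ → Fun σ) :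
    PowerSeries.derivative (Fun σ) (expXi x) =
      expXi x * PowerSeries.derivative (Fun σ) (xi x) := by
  rw [expXi_eq_subst, PowerSeries.derivative_subst (xi_hasSubst x), PowerSeries.derivative_exp]

theorem constantCoeff_expXi (x : ℕ+ → Fun σ) : PowerSeries.constantCoeff (expXi x) = 1 := by
  rw [← PowerSeries.coeff_zero_eq_constantCoeff_apply, coeff_expXi, finsum_eq_single _ 0]
  · simp
  · intro n hn
    simp [constantCoeff_xi, hn]

instance : IsAddTorsionFree (Fun σ) := IsAddTorsionFree.of_module_rat _

/-- The functional equations of `expXi` below are all proved this way: a product that should be `1`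
has vanishing `z`-derivative and constant term `1`. -/
theorem eq_one_of_derivative_eq_zero {Y : PowerSeries (Fun σ)}
    (h : PowerSeries.derivative (Fun σ) Y = 0) (h1 : PowerSeries.constantCoeff Y = 1) : Y = 1 :=
  PowerSeries.derivative.ext (by rw [h, PowerSeries.derivative_one]) (by simp [h1])

theorem expXi_mul_expXi_neg (x : ℕ+ → Fun σ) : expXi x * expXi (-x) = 1 := by
  refine eq_one_of_derivative_eq_zero ?_ (by simp [constantCoeff_expXi])
  rw [Derivation.leibniz, derivative_expXi, derivative_expXi, xi_neg, map_neg]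
  simp only [smul_eq_mul]
  ring

theorem expXi_add (x y : ℕ+ → Fun σ) : expXi (x + y) = expXi x * expXi y := by
  have h : expXi x * expXi y * expXi (-(x + y)) = 1 := by
    refine eq_one_of_derivative_eq_zero ?_ (by simp [constantCoeff_expXi])
    rw [Derivation.leibniz, Derivation.leibniz, derivative_expXi, derivative_expXi,
      derivative_expXi, xi_neg, xi_add, map_neg, map_add]
    simp only [smul_eq_mul]
    ring
  calc expXi (x + y) = expXi x * expXi y * expXi (-(x + y)) * expXi (x + y) := by rw [h, one_mul]
    _ = expXi x * expXi y * (expXi (x + y) * expXi (-(x + y))) := by ring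
    _ = _ := by rw [expXi_mul_expXi_neg, mul_one]

/-- `e^{∑ x^k z^k / k} (1 - x z) = 1`. -/
theorem expXi_geometric (x : Fun σ) :
    expXi (fun k => C (1 / ((k : ℕ) : ℂ)) * x ^ (k : ℕ)) *
      (1 - PowerSeries.C x * PowerSeries.X) = 1 := by
  set a : ℕ+ → Fun σ := fun k => C (1 / ((k : ℕ) : ℂ)) * x ^ (k : ℕ)
  have hd : PowerSeries.derivative (Fun σ) (xi a) = PowerSeries.mk fun n => x ^ (n + 1) := by
    ext1 n
    have : (C (1 / ((n : ℂ) + 1)) : Fun σ) * ((n : Fun σ) + 1) = 1 := by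
      have h2 : ((n : Fun σ) + 1) = C ((n : ℂ) + 1) := by simp
      rw [h2, ← map_mul, one_div_mul_cancel (by exact_mod_cast Nat.succ_ne_zero n), map_one]
    rw [PowerSeries.coeff_derivative, coeff_succ_xi, PowerSeries.coeff_mk]
    simp only [a, Nat.succPNat_coe, Nat.cast_succ]
    calc _ = (C (1 / ((n : ℂ) + 1)) * ((n : Fun σ) + 1)) * x ^ (n + 1) := by
            simp only [Nat.succ_eq_add_one]; ring
      _ = _ := by rw [this, one_mul]
  have hg : (PowerSeries.mk fun n => x ^ (n + 1)) * (1 - PowerSeries.C x * PowerSeries.X) =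
      PowerSeries.C x := by
    ext1 n
    rw [mul_sub, mul_one, mul_comm (PowerSeries.C x), ← mul_assoc]
    cases n with
    | zero => simp
    | succ n => simp [PowerSeries.coeff_succ_mul_X]; ring
  refine eq_one_of_derivative_eq_zero ?_ (by simp [constantCoeff_expXi])
  have h1 : PowerSeries.derivative (Fun σ) (1 - PowerSeries.C x * PowerSeries.X) =
      -PowerSeries.C x := by
    rw [map_sub, Derivation.leibniz]
    simp
  rw [Derivation.leibniz, derivative_expXi, hd, h1, smul_eq_mul, smul_eq_mul]
  linear_combination expXi a * hg

/-- The coefficient of `z^k` contains only monomials of weight at least `k`. -/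
def LowWeight (w : σ → ℕ) (E : PowerSeries (Fun σ)) : Prop :=
  ∀ k d, Finsupp.weight w d < k → coeff d (PowerSeries.coeff k E) = 0

theorem LowWeight.mul {w : σ → ℕ} {E F : PowerSeries (Fun σ)} (hE : LowWeight w E)
    (hF : LowWeight w F) : LowWeight w (E * F) := by
  classical
  intro k d hd
  rw [PowerSeries.coeff_mul, map_sum]
  refine Finset.sum_eq_zero fun p hp => ?_
  rw [coeff_mul]
  refine Finset.sum_eq_zero fun q hq => ?_
  have h1 := Finset.HasAntidiagonal.mem_antidiagonal.mp hp
  have h2 := Finset.HasAntidiagonal.mem_antidiagonal.mp hq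
  have h3 : Finsupp.weight w q.1 + Finsupp.weight w q.2 < p.1 + p.2 := by
    rw [← map_add, h2, h1]; exact hd
  by_cases h : Finsupp.weight w q.1 < p.1
  · rw [hE _ _ h, zero_mul]
  · rw [hF _ _ (by omega), mul_zero]

theorem LowWeight.one (w : σ → ℕ) : LowWeight w 1 := by
  intro k d hd
  simp [PowerSeries.coeff_one, show k ≠ 0 by omega]

theorem LowWeight.pow {w : σ → ℕ} {E : PowerSeries (Fun σ)} (hE : LowWeight w E) (n : ℕ) :
    LowWeight w (E ^ n) := by
  induction n with
  | zero => simpa using LowWeight.one w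
  | succ n ih => rw [pow_succ]; exact ih.mul hE

theorem LowWeight.expXi {w : σ → ℕ} {x : ℕ+ → Fun σ}
    (hx : ∀ (k : ℕ+) d, Finsupp.weight w d < (k : ℕ) → coeff d (x k) = 0) : LowWeight w (expXi x) := by
  have h : LowWeight w (xi x) := by
    intro k d hd
    cases k with
    | zero => omega
    | succ k => rw [coeff_succ_xi]; exact hx _ _ hd
  intro k d hd
  change (coeff d).toAddMonoidHom (PowerSeries.coeff k (LargeBKP.expXi x)) = 0
  rw [coeff_expXi, AddMonoidHom.map_finsum _
    (PowerSeries.coeff_subst_finite' (xi_hasSubst x) _ k)]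
  refine finsum_eq_zero_of_forall_eq_zero fun n => ?_
  change coeff d (PowerSeries.coeff n (PowerSeries.exp ℂ) • PowerSeries.coeff k (xi x ^ n)) = 0
  rw [map_smul, h.pow n k d hd, smul_zero]

/-- The weight of a monomial bounds the powers of `z` that accompany it. This is why `e^{ξ}`,
although infinite in positive powers of `z`, may be multiplied by series in `z⁻¹`. -/
theorem LowWeight.regular {w : σ → ℕ} {E : PowerSeries (Fun σ)} (hE : LowWeight w E) :
    Regular (ofZ E) := fun d => ⟨Finsupp.weight w d, fun k hk => by
  by_cases h : 0 ≤ k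
  · simpa [ofZ, h] using hE k.toNat d (by omega)
  · simp [ofZ, h]⟩

end ExpXi

/-- The weights `t_k ↦ k`, `t'_k ↦ k`, `t''_k ↦ k`. -/
def wt₂ : ℕ+ ⊕ ℕ+ → ℕ := Sum.elim (fun k => k) (fun k => k)

theorem coeff_X_eq_zero_of_weight_lt {σ : Type} (w : σ → ℕ) (s : σ) (d : σ →₀ ℕ)
    (h : Finsupp.weight w d < w s) : coeff d (X s : Fun σ) = 0 := by
  classical
  rw [coeff_X, if_neg]
  rintro rfl
  simp [Finsupp.weight_single] at h

theorem lowWeight_expXi_t₁ : LowWeight wt₂ (expXi t₁) :=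
  LowWeight.expXi fun k d hd => coeff_X_eq_zero_of_weight_lt _ (Sum.inl k) d hd

theorem lowWeight_expXi_t₂ : LowWeight wt₂ (expXi t₂) :=
  LowWeight.expXi fun k d hd => coeff_X_eq_zero_of_weight_lt _ (Sum.inr k) d hd

theorem lowWeight_expXi_neg_t₁ : LowWeight wt₂ (expXi (-t₁)) :=
  LowWeight.expXi fun k d hd => by
    simp [t₁, coeff_X_eq_zero_of_weight_lt wt₂ (Sum.inl k) d hd]

theorem lowWeight_expXi_neg_t₂ : LowWeight wt₂ (expXi (-t₂)) :=
  LowWeight.expXi fun k d hd => by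
    simp [t₂, coeff_X_eq_zero_of_weight_lt wt₂ (Sum.inr k) d hd]

/-! ### Power series with one additional variable in the role of `z⁻¹` -/

section OptionVariables

variable {σ τ υ : Type}

theorem coeff_optionEquivLeft_symm (A : PowerSeries (Fun σ)) (e : Option σ →₀ ℕ) :
    coeff e ((optionEquivLeft σ ℂ).symm A) = coeff e.some (PowerSeries.coeff (e none) A) := by
  obtain ⟨f, rfl⟩ := (optionEquivLeft σ ℂ).surjective A
  rw [AlgEquiv.symm_apply_apply, coeff_coeff_optionEquivLeft, Finsupp.optionElim_some]

/-- A function of `t`, viewed as independent of the additional variable. -/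
noncomputable def incl (σ : Type) : Fun σ →ₐ[ℂ] Fun (Option σ) :=
  (optionEquivLeft σ ℂ).symm.toAlgHom.comp (IsScalarTower.toAlgHom ℂ (Fun σ) (PowerSeries (Fun σ)))

theorem optionEquivLeft_incl (f : Fun σ) : optionEquivLeft σ ℂ (incl σ f) = PowerSeries.C f :=
  (optionEquivLeft σ ℂ).apply_symm_apply _

theorem incl_X (s : σ) : incl σ (X s) = X (some s) := by
  apply (optionEquivLeft σ ℂ).injective
  rw [optionEquivLeft_incl, optionEquivLeft_X_some]

theorem finDet_incl : FinDet (incl σ) := by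
  classical
  intro e
  refine ⟨{e.some}, fun f g h => ?_⟩
  change coeff e ((optionEquivLeft σ ℂ).symm (PowerSeries.C f)) =
    coeff e ((optionEquivLeft σ ℂ).symm (PowerSeries.C g))
  rw [coeff_optionEquivLeft_symm, coeff_optionEquivLeft_symm, PowerSeries.coeff_C,
    PowerSeries.coeff_C]
  split_ifs
  · exact h _ (by simp)
  · rfl

/-- A homomorphism applied to the coefficients of the powers of the additional variable. -/
noncomputable def optionMap (Φ : Fun σ →ₐ[ℂ] Fun τ) : Fun (Option σ) →ₐ[ℂ] Fun (Option τ) :=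
  (optionEquivLeft τ ℂ).symm.toAlgHom.comp
    ((PowerSeries.mapAlgHom Φ).comp (optionEquivLeft σ ℂ).toAlgHom)

theorem optionEquivLeft_optionMap (Φ : Fun σ →ₐ[ℂ] Fun τ) (f : Fun (Option σ)) :
    optionEquivLeft τ ℂ (optionMap Φ f) =
      PowerSeries.map Φ.toRingHom (optionEquivLeft σ ℂ f) :=
  (optionEquivLeft τ ℂ).apply_symm_apply _

theorem optionEquivLeft_symm_map (Φ : Fun σ →ₐ[ℂ] Fun τ) (A : PowerSeries (Fun σ)) :
    (optionEquivLeft τ ℂ).symm (PowerSeries.map Φ.toRingHom A) =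
      optionMap Φ ((optionEquivLeft σ ℂ).symm A) := by
  apply (optionEquivLeft τ ℂ).injective
  rw [optionEquivLeft_optionMap, AlgEquiv.apply_symm_apply, AlgEquiv.apply_symm_apply]

theorem optionMap_X_none (Φ : Fun σ →ₐ[ℂ] Fun τ) : optionMap Φ (X none) = X none := by
  apply (optionEquivLeft τ ℂ).injective
  rw [optionEquivLeft_optionMap, optionEquivLeft_X_none, optionEquivLeft_X_none, PowerSeries.map_X]

theorem optionMap_X_some (Φ : Fun σ →ₐ[ℂ] Fun τ) (s : σ) :
    optionMap Φ (X (some s)) = incl τ (Φ (X s)) := by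
  apply (optionEquivLeft τ ℂ).injective
  rw [optionEquivLeft_optionMap, optionEquivLeft_X_some, optionEquivLeft_incl, PowerSeries.map_C]
  rfl

theorem finDet_optionMap {Φ : Fun σ →ₐ[ℂ] Fun τ} (hΦ : FinDet Φ) : FinDet (optionMap Φ) := by
  classical
  intro e
  obtain ⟨D, hD⟩ := hΦ e.some
  refine ⟨D.image fun d => d.optionElim (e none), fun f g h => ?_⟩
  rw [← Finsupp.optionElim_some e, ← coeff_coeff_optionEquivLeft, ← coeff_coeff_optionEquivLeft,
    optionEquivLeft_optionMap, optionEquivLeft_optionMap, PowerSeries.coeff_map,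
    PowerSeries.coeff_map]
  refine hD _ _ fun d hd => ?_
  rw [coeff_coeff_optionEquivLeft, coeff_coeff_optionEquivLeft]
  exact h _ (Finset.mem_image_of_mem _ hd)

theorem finDet_substAlgHom {a : σ → Fun τ} (ha : HasSubst a) :
    FinDet (substAlgHom (R := ℂ) ha) := by
  rw [coe_substAlgHom]
  exact FinDet.subst ha

theorem hasSubst_optionElim {p : σ → Fun τ} (hp : HasSubst p) {v : Fun τ}
    (hv : constantCoeff v = 0) : HasSubst (fun o : Option σ => o.elim v p) where
  const_coeff o := by
    cases o with
    | none => simp [hv]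
    | some s => exact hp.const_coeff s
  coeff_zero d := by
    refine (((hp.coeff_zero d).image some).insert none).subset fun o ho => ?_
    cases o with
    | none => exact Or.inl rfl
    | some s => exact Or.inr ⟨s, ho, rfl⟩

/-- The substitution `t ↦ p`, `u ↦ v`. -/
noncomputable def evalOpt {p : σ → Fun τ} (hp : HasSubst p) {v : Fun τ}
    (hv : constantCoeff v = 0) : Fun (Option σ) →ₐ[ℂ] Fun τ :=
  substAlgHom (hasSubst_optionElim hp hv)

theorem finDet_evalOpt {p : σ → Fun τ} (hp : HasSubst p) {v : Fun τ}
    (hv : constantCoeff v = 0) : FinDet (evalOpt hp hv) := finDet_substAlgHom _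

theorem evalOpt_X_none {p : σ → Fun τ} (hp : HasSubst p) {v : Fun τ}
    (hv : constantCoeff v = 0) : evalOpt hp hv (X none) = v := substAlgHom_X _ _

theorem evalOpt_X_some {p : σ → Fun τ} (hp : HasSubst p) {v : Fun τ}
    (hv : constantCoeff v = 0) (s : σ) : evalOpt hp hv (X (some s)) = p s := substAlgHom_X _ _

theorem evalOpt_incl {p : σ → Fun τ} (hp : HasSubst p) {v : Fun τ}
    (hv : constantCoeff v = 0) (f : Fun σ) : evalOpt hp hv (incl σ f) = substAlgHom hp f := by
  suffices h : (evalOpt hp hv).comp (incl σ) = substAlgHom hp from DFunLike.congr_fun h f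
  refine FinDet.ext_algHom ((finDet_evalOpt hp hv).comp finDet_incl) (finDet_substAlgHom hp)
    fun s => ?_
  rw [AlgHom.comp_apply, incl_X, evalOpt_X_some, substAlgHom_X]

theorem evalOpt_monomial {p : σ → Fun τ} (hp : HasSubst p) {v : Fun τ}
    (hv : constantCoeff v = 0) (d : Option σ →₀ ℕ) (r : ℂ) :
    evalOpt hp hv (monomial d r) = substAlgHom hp (monomial d.some r) * v ^ d none := by
  have h : (monomial d r : Fun (Option σ)) = incl σ (monomial d.some r) * X none ^ d none := by
    apply (optionEquivLeft σ ℂ).injective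
    rw [map_mul, optionEquivLeft_incl, map_pow, optionEquivLeft_X_none, optionEquivLeft_monomial,
      PowerSeries.monomial_eq_C_mul_X_pow]
  rw [h, map_mul, evalOpt_incl, map_pow, evalOpt_X_none]

/-- Composites of substitutions are compared on the variables only; continuity does the rest. The
next two lemmas are variants. -/
theorem evalOpt_optionMap {p : τ → Fun υ} (hp : HasSubst p) {v : Fun υ}
    (hv : constantCoeff v = 0) {Φ : Fun σ →ₐ[ℂ] Fun τ} (hΦ : FinDet Φ) {q : σ → Fun υ}
    (hq : HasSubst q) (h : ∀ s, substAlgHom hp (Φ (X s)) = q s) (f : Fun (Option σ)) :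
    evalOpt hp hv (optionMap Φ f) = evalOpt hq hv f := by
  suffices h : (evalOpt hp hv).comp (optionMap Φ) = evalOpt hq hv from DFunLike.congr_fun h f
  refine FinDet.ext_algHom ((finDet_evalOpt hp hv).comp (finDet_optionMap hΦ))
    (finDet_evalOpt hq hv) fun o => ?_
  cases o with
  | none => rw [AlgHom.comp_apply, optionMap_X_none, evalOpt_X_none, evalOpt_X_none]
  | some s => rw [AlgHom.comp_apply, optionMap_X_some, evalOpt_incl, evalOpt_X_some, h]

theorem algHom_evalOpt {p : σ → Fun τ} (hp : HasSubst p) {v : Fun τ}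
    (hv : constantCoeff v = 0) {Φ : Fun τ →ₐ[ℂ] Fun υ} (hΦ : FinDet Φ) {q : σ → Fun υ}
    (hq : HasSubst q) {w : Fun υ} (hw : constantCoeff w = 0)
    (h : ∀ s, Φ (p s) = q s) (hvw : Φ v = w) (f : Fun (Option σ)) :
    Φ (evalOpt hp hv f) = evalOpt hq hw f := by
  suffices h : Φ.comp (evalOpt hp hv) = evalOpt hq hw from DFunLike.congr_fun h f
  refine FinDet.ext_algHom (hΦ.comp (finDet_evalOpt hp hv)) (finDet_evalOpt hq hw) fun o => ?_
  cases o with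
  | none => rw [AlgHom.comp_apply, evalOpt_X_none, evalOpt_X_none, hvw]
  | some s => rw [AlgHom.comp_apply, evalOpt_X_some, evalOpt_X_some, h]

theorem algHom_substAlgHom {p : σ → Fun τ} (hp : HasSubst p) {Φ : Fun τ →ₐ[ℂ] Fun υ}
    (hΦ : FinDet Φ) {q : σ → Fun υ} (hq : HasSubst q) (h : ∀ s, Φ (p s) = q s) (f : Fun σ) :
    Φ (substAlgHom hp f) = substAlgHom hq f := by
  suffices h : Φ.comp (substAlgHom hp) = substAlgHom hq from DFunLike.congr_fun h f
  refine FinDet.ext_algHom (hΦ.comp (finDet_substAlgHom hp)) (finDet_substAlgHom hq) fun s => ?_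
  rw [AlgHom.comp_apply, substAlgHom_X, substAlgHom_X, h]

end OptionVariables

/-! ### The residue pairing and its evaluation on special kernels -/

section Residue

variable {σ τ : Type}

/-- `Res_z z^{m-2} P(z⁻¹) E(z)`. -/
noncomputable def residue (m : ℤ) (P E : PowerSeries (Fun σ)) : Fun σ :=
  resZ (zMul (m - 2) (mulZ (ofInvZ P) (ofZ E)))

theorem coeff_residue (m : ℤ) (P E : PowerSeries (Fun σ)) (d : σ →₀ ℕ) :
    coeff d (residue m P E) = ∑ᶠ a : ℤ, coeff d (ofInvZ P a * ofZ E (-1 - (m - 2) - a)) := rfl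

theorem residue_monomial (m : ℤ) (j : ℕ) (c : Fun σ) (E : PowerSeries (Fun σ)) :
    residue m (PowerSeries.monomial j c) E = c * ofZ E (1 - m + j) := by
  ext d
  rw [coeff_residue, finsum_eq_single _ (-(j : ℤ))]
  · have h : ofInvZ (PowerSeries.monomial j c) (-(j : ℤ)) = c := by
      simp [ofInvZ]
    rw [h]
    congr 3
    ring
  · intro a ha
    have h : ofInvZ (PowerSeries.monomial j c) a = 0 := by
      unfold ofInvZ
      split_ifs
      · rw [PowerSeries.coeff_monomial, if_neg (by omega)]
      · rfl
    rw [h, zero_mul, map_zero]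

/-- A `finsum` is additive only when supports are finite, so the sum is taken in the ring of Laurent
coefficients, where regularity of `E` places it. -/
theorem residue_add {w : σ → ℕ} {E : PowerSeries (Fun σ)} (hE : LowWeight w E) (m : ℤ)
    (P Q : PowerSeries (Fun σ)) : residue m (P + Q) E = residue m P E + residue m Q E := by
  obtain ⟨F, hF⟩ := (regular_ofInvZ P).exists_ofLaurent
  obtain ⟨G, hG⟩ := (regular_ofInvZ Q).exists_ofLaurent
  obtain ⟨H, hH⟩ := hE.regular.exists_ofLaurent
  have hFG : ofInvZ (P + Q) = ofLaurent (F + G) := by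
    refine funext fun k => ext fun d => ?_
    rw [coeff_ofLaurent, map_add, HahnSeries.coeff_add, ← coeff_ofLaurent, ← coeff_ofLaurent,
      hF, hG, ← map_add]
    congr 1
    unfold ofInvZ
    split_ifs <;> simp
  ext d
  rw [map_add]
  simp only [residue, ← hF, ← hG, ← hH, hFG, mulZ_ofLaurent, resZ, zMul, coeff_ofLaurent]
  rw [add_mul, map_add, HahnSeries.coeff_add]

theorem residue_C_mul {w : σ → ℕ} {E : PowerSeries (Fun σ)} (hE : LowWeight w E) (m : ℤ)
    (c : Fun σ) (P : PowerSeries (Fun σ)) :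
    residue m (PowerSeries.C c * P) E = c * residue m P E := by
  unfold residue
  rw [← mulZ_ofInvZ, mulZ_assoc (regular_ofInvZ _) (regular_ofInvZ _) hE.regular]
  exact mulZ_ofInvZ_C _ _ _

theorem finDet_residue {w : σ → ℕ} {E : PowerSeries (Fun σ)} (hE : LowWeight w E) (m : ℤ) :
    FinDet (fun P : Fun (Option σ) => residue m (optionEquivLeft σ ℂ P) E) := by
  classical
  intro d
  -- The term `z^{-j}` of `P` meets `z^{1-m+j}` of the kernel, which contributes only if `1 - m + j`
  -- is at most the weight of `d`.
  refine ⟨(Finset.range ((m - 1 + Finsupp.weight w d).toNat + 1) ×ˢ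
    Finset.HasAntidiagonal.antidiagonal d).image fun x => x.2.1.optionElim x.1, fun f g h => ?_⟩
  rw [coeff_residue, coeff_residue]
  refine finsum_congr fun a => ?_
  rw [coeff_mul, coeff_mul]
  refine Finset.sum_congr rfl fun q hq => ?_
  by_cases ha : a ≤ 0
  · by_cases hb : (-a).toNat < (m - 1 + Finsupp.weight w d).toNat + 1
    · congr 1
      simp only [ofInvZ, ha, if_true]
      rw [coeff_coeff_optionEquivLeft, coeff_coeff_optionEquivLeft]
      exact h _ (Finset.mem_image.mpr ⟨((-a).toNat, q), Finset.mem_product.mpr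
        ⟨Finset.mem_range.mpr hb, hq⟩, rfl⟩)
    · have h0 : coeff q.2 (ofZ E (-1 - (m - 2) - a)) = 0 := by
        unfold ofZ
        split_ifs
        · refine hE _ _ ?_
          have := congrArg (Finsupp.weight w) (Finset.HasAntidiagonal.mem_antidiagonal.mp hq)
          rw [map_add] at this
          omega
        · rfl
      rw [h0, mul_zero, mul_zero]
  · simp [ofInvZ, ha]

theorem ofZ_map (Φ : Fun σ →ₐ[ℂ] Fun τ) (E : PowerSeries (Fun σ)) (k : ℤ) :
    Φ (ofZ E k) = ofZ (PowerSeries.map Φ.toRingHom E) k := by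
  unfold ofZ
  split_ifs
  · rw [PowerSeries.coeff_map]; rfl
  · exact map_zero Φ

theorem ofInvZ_map (Φ : Fun σ →ₐ[ℂ] Fun τ) (E : PowerSeries (Fun σ)) (k : ℤ) :
    Φ (ofInvZ E k) = ofInvZ (PowerSeries.map Φ.toRingHom E) k := by
  unfold ofInvZ
  split_ifs
  · rw [PowerSeries.coeff_map]; rfl
  · exact map_zero Φ

/-- The residue pairing with a kernel that becomes `1 / ((1 - x z) (1 - y z))`. -/
theorem residue_pole {w : σ → ℕ} {E : PowerSeries (Fun σ)} (hE : LowWeight w E)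
    {p : σ → Fun τ} (hp : HasSubst p) {x y : Fun τ} (hx : constantCoeff x = 0)
    (hy : constantCoeff y = 0)
    (hF : ∀ k, (x - y) * PowerSeries.coeff k (PowerSeries.map (substAlgHom hp).toRingHom E) =
      x ^ (k + 1) - y ^ (k + 1)) (q : ℕ) (P : Fun (Option σ)) :
    (x - y) * substAlgHom hp (residue (2 - q) (optionEquivLeft σ ℂ P) E) =
      x ^ q * evalOpt hp hx P - y ^ q * evalOpt hp hy P := by
  let r : Fun (Option σ) →+ Fun σ :=
    { toFun := fun P => residue (2 - q) (optionEquivLeft σ ℂ P) E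
      map_zero' := by
        have := residue_C_mul hE (2 - q) 0 0
        rw [map_zero]
        simpa using this
      map_add' := fun P Q => by rw [map_add, residue_add hE] }
  let L : Fun (Option σ) →+ Fun τ :=
    (AddMonoidHom.mulLeft (x - y)).comp ((substAlgHom hp).toLinearMap.toAddMonoidHom.comp r)
  let M : Fun (Option σ) →+ Fun τ :=
    (AddMonoidHom.mulLeft (x ^ q)).comp (evalOpt hp hx).toLinearMap.toAddMonoidHom -
      (AddMonoidHom.mulLeft (y ^ q)).comp (evalOpt hp hy).toLinearMap.toAddMonoidHom
  suffices h : L = M from DFunLike.congr_fun h P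
  refine FinDet.ext_monomial ?_ ?_ fun d c => ?_
  · exact (FinDet.const (x - y)).mul ((finDet_substAlgHom hp).comp (finDet_residue hE _))
  · exact ((FinDet.const (x ^ q)).mul (finDet_evalOpt hp hx)).sub
      ((FinDet.const (y ^ q)).mul (finDet_evalOpt hp hy))
  · change (x - y) * substAlgHom hp (residue (2 - q) (optionEquivLeft σ ℂ (monomial d c)) E) =
      x ^ q * evalOpt hp hx (monomial d c) - y ^ q * evalOpt hp hy (monomial d c)
    rw [optionEquivLeft_monomial, residue_monomial, map_mul, ofZ_map, evalOpt_monomial,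
      evalOpt_monomial]
    by_cases h : (0 : ℤ) ≤ 1 - (2 - q) + d none
    · have := hF (1 - (2 - (q : ℤ)) + d none).toNat
      rw [show (1 - (2 - (q : ℤ)) + d none).toNat + 1 = q + d none by omega] at this
      simp only [ofZ, h, if_true]
      rw [mul_left_comm, this]
      ring
    · have h1 : q = 0 := by omega
      have h2 : d none = 0 := by omega
      simp [ofZ, h1, h2]

/-- The residue pairing with a kernel that becomes a polynomial in `z` of degree at most
`m + 1`. -/
theorem residue_polynomial {w : σ → ℕ} {E : PowerSeries (Fun σ)} (hE : LowWeight w E)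
    {p : σ → Fun τ} (hp : HasSubst p) (m : ℕ)
    (hF : ∀ k, m + 1 < k → PowerSeries.coeff k (PowerSeries.map (substAlgHom hp).toRingHom E) = 0)
    (P : Fun (Option σ)) :
    substAlgHom hp (residue (-m) (optionEquivLeft σ ℂ P) E) =
      PowerSeries.coeff (m + 1) (PowerSeries.map (substAlgHom hp).toRingHom E) *
        evalOpt hp (map_zero constantCoeff) P := by
  let r : Fun (Option σ) →+ Fun σ :=
    { toFun := fun P => residue (-m) (optionEquivLeft σ ℂ P) E
      map_zero' := by
        have := residue_C_mul hE (-m) 0 0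
        rw [map_zero]
        simpa using this
      map_add' := fun P Q => by rw [map_add, residue_add hE] }
  set F := PowerSeries.map (substAlgHom hp).toRingHom E
  let L : Fun (Option σ) →+ Fun τ := (substAlgHom hp).toLinearMap.toAddMonoidHom.comp r
  let M : Fun (Option σ) →+ Fun τ := (AddMonoidHom.mulLeft (PowerSeries.coeff (m + 1) F)).comp
    (evalOpt hp (map_zero constantCoeff)).toLinearMap.toAddMonoidHom
  suffices h : L = M from DFunLike.congr_fun h P
  refine FinDet.ext_monomial ?_ ?_ fun d c => ?_
  · exact (finDet_substAlgHom hp).comp (finDet_residue hE _)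
  · exact (FinDet.const _).mul (finDet_evalOpt hp (map_zero constantCoeff))
  · change substAlgHom hp (residue (-m) (optionEquivLeft σ ℂ (monomial d c)) E) =
      PowerSeries.coeff (m + 1) F * evalOpt hp (map_zero constantCoeff) (monomial d c)
    rw [optionEquivLeft_monomial, residue_monomial, map_mul, ofZ_map, evalOpt_monomial]
    have h : (0 : ℤ) ≤ 1 - (-m) + d none := by omega
    simp only [ofZ, h, if_true]
    -- The term `z^{-j}` is paired with the kernel coefficient at `m + 1 + j`. The degree bound
    -- leaves only `j = 0`, which evaluation at `z⁻¹ = 0` also selects.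
    by_cases hd : d none = 0
    · rw [show (1 - (-(m : ℤ)) + d none).toNat = m + 1 by omega, hd, pow_zero, mul_one, mul_comm]
    · rw [hF _ (show m + 1 < (1 - (-(m : ℤ)) + d none).toNat by omega), zero_pow hd]
      simp

end Residue

/-! ### From wave functions to amplitudes -/

/-- The bilinear identity for the amplitudes `A_n^±(t, z)` of the wave functions. -/
def AmplitudeBilinear (P Q : ℤ → PowerSeries (Fun ℕ+)) : Prop :=
  ∀ n' n'' : ℤ,
    residue (n' - n'') (PowerSeries.map at₁.toRingHom (P n') *
        PowerSeries.map at₂.toRingHom (Q n'')) (expXi (t₁ - t₂)) +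
      residue (n'' - n') (PowerSeries.map at₁.toRingHom (Q n') *
        PowerSeries.map at₂.toRingHom (P n'')) (expXi (-(t₁ - t₂))) =
      C ((1 - (-1 : ℂ) ^ (n' - n'')) / 2)

theorem at₁_t (k : ℕ+) : at₁ (t k) = t₁ k := rename_X _ _

theorem at₂_t (k : ℕ+) : at₂ (t k) = t₂ k := rename_X _ _

theorem map_zMul_mulZ {σ τ : Type} (e : σ ↪ τ) (m : ℤ) (A : PowerSeries (Fun σ))
    (x : ℕ+ → Fun σ) :
    (fun k => rename (R := ℂ) e (zMul m (mulZ (ofInvZ A) (ofZ (expXi x))) k)) =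
      zMul m (mulZ (ofInvZ (PowerSeries.map (rename (R := ℂ) e).toRingHom A))
        (ofZ (expXi fun k => rename e (x k)))) := by
  change zMul m (fun k => rename (R := ℂ) e (mulZ (ofInvZ A) (ofZ (expXi x)) k)) = _
  rw [rename_mulZ]
  simp_rw [ofInvZ_map, ofZ_map, map_expXi]

theorem lowWeight_expXi_sub : LowWeight wt₂ (expXi (t₁ - t₂)) := by
  rw [sub_eq_add_neg, expXi_add]
  exact lowWeight_expXi_t₁.mul lowWeight_expXi_neg_t₂

theorem lowWeight_expXi_neg_sub : LowWeight wt₂ (expXi (-(t₁ - t₂))) := by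
  rw [neg_sub, sub_eq_add_neg, expXi_add]
  exact lowWeight_expXi_t₂.mul lowWeight_expXi_neg_t₁

/-- Regularity of all four factors allows the amplitudes and the exponentials to be collected
separately. The powers of `z` add up to `n' + (-n'' - 1) - 1 = (n' - n'') - 2`, the normalization
built into `residue`. -/
theorem resZ_plusForm_minusForm (n' n'' : ℤ) (A B : PowerSeries (Fun ℕ+)) :
    resZ (zMul (-1) (mulZ (fun k => at₁ (plusForm n' A k)) (fun k => at₂ (minusForm n'' B k)))) =
      residue (n' - n'') (PowerSeries.map at₁.toRingHom A * PowerSeries.map at₂.toRingHom B)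
        (expXi (t₁ - t₂)) := by
  have h1 := map_zMul_mulZ (Function.Embedding.inl : ℕ+ ↪ ℕ+ ⊕ ℕ+) n' A t
  have h2 := map_zMul_mulZ (Function.Embedding.inr : ℕ+ ↪ ℕ+ ⊕ ℕ+) (-n'' - 1) B (-t)
  have e1 : (fun k => rename (R := ℂ) (Function.Embedding.inl : ℕ+ ↪ ℕ+ ⊕ ℕ+) (t k)) = t₁ :=
    funext at₁_t
  have e2 : (fun k => rename (R := ℂ) (Function.Embedding.inr : ℕ+ ↪ ℕ+ ⊕ ℕ+) ((-t) k)) = -t₂ :=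
    funext fun k => by rw [Pi.neg_apply, map_neg]; exact congrArg _ (at₂_t k)
  rw [e1] at h1
  rw [e2] at h2
  unfold plusForm minusForm at₁ at₂
  rw [h1, h2, mulZ_zMul_zMul, zMul_zMul, mulZ_mulZ_mulZ_comm (regular_ofInvZ _)
    lowWeight_expXi_t₁.regular (regular_ofInvZ _) lowWeight_expXi_neg_t₂.regular, mulZ_ofInvZ,
    mulZ_ofZ, ← expXi_add, ← sub_eq_add_neg, residue]
  congr 2
  ring

theorem resZ_minusForm_plusForm (n' n'' : ℤ) (A B : PowerSeries (Fun ℕ+)) :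
    resZ (zMul (-1) (mulZ (fun k => at₁ (minusForm n' A k)) (fun k => at₂ (plusForm n'' B k)))) =
      residue (n'' - n') (PowerSeries.map at₁.toRingHom A * PowerSeries.map at₂.toRingHom B)
        (expXi (-(t₁ - t₂))) := by
  have h1 := map_zMul_mulZ (Function.Embedding.inl : ℕ+ ↪ ℕ+ ⊕ ℕ+) (-n' - 1) A (-t)
  have h2 := map_zMul_mulZ (Function.Embedding.inr : ℕ+ ↪ ℕ+ ⊕ ℕ+) n'' B t
  have e1 : (fun k => rename (R := ℂ) (Function.Embedding.inl : ℕ+ ↪ ℕ+ ⊕ ℕ+) ((-t) k)) = -t₁ :=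
    funext fun k => by rw [Pi.neg_apply, map_neg]; exact congrArg _ (at₁_t k)
  have e2 : (fun k => rename (R := ℂ) (Function.Embedding.inr : ℕ+ ↪ ℕ+ ⊕ ℕ+) (t k)) = t₂ :=
    funext at₂_t
  rw [e1] at h1
  rw [e2] at h2
  unfold plusForm minusForm at₁ at₂
  rw [h1, h2, mulZ_zMul_zMul, zMul_zMul, mulZ_mulZ_mulZ_comm (regular_ofInvZ _)
    lowWeight_expXi_neg_t₁.regular (regular_ofInvZ _) lowWeight_expXi_t₂.regular, mulZ_ofInvZ,
    mulZ_ofZ, ← expXi_add, residue, show -t₁ + t₂ = -(t₁ - t₂) by ring]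
  congr 2
  ring

theorem WaveBilinear.amplitudeBilinear {Ψp Ψm : ℤ → ZSeries ℕ+}
    {P Q : ℤ → PowerSeries (Fun ℕ+)} (hP : ∀ n, Ψp n = plusForm n (P n))
    (hQ : ∀ n, Ψm n = minusForm n (Q n)) (h : WaveBilinear Ψp Ψm) : AmplitudeBilinear P Q := by
  intro n' n''
  rw [← h n' n'', zMul_add]
  simp_rw [hP, hQ]
  rw [← resZ_plusForm_minusForm, ← resZ_minusForm_plusForm]
  rfl

/-! ### The kernel at times `[x]` and `[x] + [y]` -/

section Kernel

variable {τ : Type}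

/-- The times `[x] = (x, x²/2, x³/3, …)`. -/
noncomputable def bracket (x : Fun τ) (k : ℕ+) : Fun τ := C (1 / ((k : ℕ) : ℂ)) * x ^ (k : ℕ)

theorem expXi_neg_bracket (x : Fun τ) :
    expXi (-bracket x) = 1 - PowerSeries.C x * PowerSeries.X := by
  have h1 : expXi (bracket x) * (1 - PowerSeries.C x * PowerSeries.X) = 1 := expXi_geometric x
  have h2 := expXi_mul_expXi_neg (bracket x)
  linear_combination (expXi (-bracket x)) * (-h1) + (1 - PowerSeries.C x * PowerSeries.X) * h2

theorem coeff_expXi_bracket (x : Fun τ) (k : ℕ) :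
    PowerSeries.coeff k (expXi (bracket x)) = x ^ k := by
  have h1 : expXi (bracket x) * (1 - PowerSeries.C x * PowerSeries.X) = 1 := expXi_geometric x
  induction k with
  | zero => simp [constantCoeff_expXi]
  | succ k ih =>
    have := congrArg (PowerSeries.coeff (k + 1)) h1
    rw [mul_sub, mul_one, mul_left_comm, ← mul_assoc, map_sub, PowerSeries.coeff_succ_mul_X,
      PowerSeries.coeff_C_mul, ih, PowerSeries.coeff_one, if_neg (Nat.succ_ne_zero k)] at this
    linear_combination this

/-- Partial fractions: `(x - y)/((1-xz)(1-yz)) = x/(1-xz) - y/(1-yz)`. The factor `x - y` stays on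
the left because it is not invertible. -/
theorem coeff_expXi_bracket_add (x y : Fun τ) (k : ℕ) :
    (x - y) * PowerSeries.coeff k (expXi (bracket x + bracket y)) = x ^ (k + 1) - y ^ (k + 1) := by
  have h1 : expXi (bracket x) * (1 - PowerSeries.C x * PowerSeries.X) = 1 := expXi_geometric x
  have h2 : expXi (bracket y) * (1 - PowerSeries.C y * PowerSeries.X) = 1 := expXi_geometric y
  have h : PowerSeries.C (x - y) * expXi (bracket x + bracket y) =
      PowerSeries.C x * expXi (bracket x) - PowerSeries.C y * expXi (bracket y) := by
    rw [expXi_add, map_sub]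
    linear_combination (PowerSeries.C x * expXi (bracket x)) * h2 -
      PowerSeries.C y * expXi (bracket y) * h1
  have := congrArg (PowerSeries.coeff k) h
  rw [PowerSeries.coeff_C_mul, map_sub, PowerSeries.coeff_C_mul, PowerSeries.coeff_C_mul,
    coeff_expXi_bracket, coeff_expXi_bracket] at this
  rw [this]
  ring

theorem bracket_zero : bracket (0 : Fun τ) = 0 := funext fun k => by simp [bracket]

end Kernel

theorem finDet_rename {σ τ : Type} (e : σ ↪ τ) : FinDet (rename (R := ℂ) e) := by
  intro d
  by_cases hd : d ∈ Set.range (Finsupp.mapDomain e)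
  · obtain ⟨c, rfl⟩ := hd
    refine ⟨{c}, fun f g h => ?_⟩
    rw [← Finsupp.embDomain_eq_mapDomain, coeff_embDomain_rename, coeff_embDomain_rename]
    exact h c (by simp)
  · exact ⟨∅, fun f g _ => by rw [coeff_rename_eq_zero _ _ hd, coeff_rename_eq_zero _ _ hd]⟩

theorem finDet_at₁ : FinDet at₁ := finDet_rename _

theorem finDet_at₂ : FinDet at₂ := finDet_rename _

theorem hasSubst_sumElim {σ ρ τ : Type} {p : σ → Fun τ} {q : ρ → Fun τ} (hp : HasSubst p)
    (hq : HasSubst q) : HasSubst (Sum.elim p q) where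
  const_coeff o := by
    cases o with
    | inl s => exact hp.const_coeff s
    | inr s => exact hq.const_coeff s
  coeff_zero d := by
    refine (((hp.coeff_zero d).image Sum.inl).union ((hq.coeff_zero d).image Sum.inr)).subset
      fun o ho => ?_
    cases o with
    | inl s => exact Or.inl ⟨s, ho, rfl⟩
    | inr s => exact Or.inr ⟨s, ho, rfl⟩

theorem evalOpt_zero {σ τ : Type} {p : σ → Fun τ} (hp : HasSubst p) (A : PowerSeries (Fun σ)) :
    evalOpt hp (map_zero constantCoeff) ((optionEquivLeft σ ℂ).symm A) =
      substAlgHom hp (PowerSeries.constantCoeff A) := by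
  obtain ⟨f, rfl⟩ := (optionEquivLeft σ ℂ).surjective A
  rw [AlgEquiv.symm_apply_apply]
  -- A series differs from its constant term by a multiple of the additional variable, which is sent
  -- to `0`.
  have key : optionEquivLeft σ ℂ f - PowerSeries.C (PowerSeries.constantCoeff
      (optionEquivLeft σ ℂ f)) = PowerSeries.X * PowerSeries.mk fun n =>
        PowerSeries.coeff (n + 1) (optionEquivLeft σ ℂ f) := by
    ext1 n
    cases n with
    | zero => simp
    | succ n => simp [PowerSeries.coeff_succ_X_mul]
  have h2 := congrArg (fun A => evalOpt hp (map_zero constantCoeff)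
    ((optionEquivLeft σ ℂ).symm A)) key
  simp only [map_sub, map_mul, AlgEquiv.symm_apply_apply] at h2
  rw [← optionEquivLeft_incl, AlgEquiv.symm_apply_apply, evalOpt_incl, ← optionEquivLeft_X_none,
    AlgEquiv.symm_apply_apply, evalOpt_X_none, zero_mul, sub_eq_zero] at h2
  exact h2

/-! ### Three specializations of the amplitude identity -/

section Substituted

variable {τ : Type} {p₁ p₂ : ℕ+ → Fun τ} {P Q : ℤ → PowerSeries (Fun ℕ+)}

/-- The amplitude as a power series in `t` and `z⁻¹`. -/
noncomputable def amp (P : ℤ → PowerSeries (Fun ℕ+)) (n : ℤ) : Fun (Option ℕ+) :=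
  (optionEquivLeft ℕ+ ℂ).symm (P n)

/-- Under `t' = p₁`, `t'' = p₂`, `z⁻¹ = x`, each factor involves only one of the two sets of times,
so the evaluation splits. -/
theorem evalOpt_mul_at (hp₁ : HasSubst p₁) (hp₂ : HasSubst p₂) {x : Fun τ}
    (hx : constantCoeff x = 0) (A B : PowerSeries (Fun ℕ+)) :
    evalOpt (hasSubst_sumElim hp₁ hp₂) hx ((optionEquivLeft _ ℂ).symm
      (PowerSeries.map at₁.toRingHom A * PowerSeries.map at₂.toRingHom B)) =
      evalOpt hp₁ hx ((optionEquivLeft _ ℂ).symm A) *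
        evalOpt hp₂ hx ((optionEquivLeft _ ℂ).symm B) := by
  rw [map_mul, map_mul, optionEquivLeft_symm_map, optionEquivLeft_symm_map,
    evalOpt_optionMap _ _ finDet_at₁ hp₁, evalOpt_optionMap _ _ finDet_at₂ hp₂]
  · intro s
    rw [show at₂ (X s) = X (Sum.inr s) from rename_X _ _, substAlgHom_X]
    rfl
  · intro s
    rw [show at₁ (X s) = X (Sum.inl s) from rename_X _ _, substAlgHom_X]
    rfl

theorem map_kernel (hp₁ : HasSubst p₁) (hp₂ : HasSubst p₂) {x y : Fun τ}
    (h : ∀ k, p₁ k - p₂ k = bracket x k + bracket y k) :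
    PowerSeries.map (substAlgHom (R := ℂ) (hasSubst_sumElim hp₁ hp₂)).toRingHom
      (expXi (t₁ - t₂)) = expXi (bracket x + bracket y) := by
  rw [map_expXi]
  congr 1
  funext k
  rw [Pi.sub_apply, map_sub, t₁, t₂, substAlgHom_X, substAlgHom_X]
  exact h k

theorem map_neg_kernel (hp₁ : HasSubst p₁) (hp₂ : HasSubst p₂) {x y : Fun τ}
    (h : ∀ k, p₁ k - p₂ k = bracket x k + bracket y k) :
    PowerSeries.map (substAlgHom (R := ℂ) (hasSubst_sumElim hp₁ hp₂)).toRingHom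
      (expXi (-(t₁ - t₂))) = (1 - PowerSeries.C x * PowerSeries.X) *
        (1 - PowerSeries.C y * PowerSeries.X) := by
  rw [map_expXi, ← expXi_neg_bracket, ← expXi_neg_bracket, ← expXi_add]
  congr 1
  funext k
  rw [Pi.neg_apply, Pi.sub_apply, map_neg, map_sub, t₁, t₂, substAlgHom_X, substAlgHom_X]
  simp only [Sum.elim_inl, Sum.elim_inr, h k, Pi.add_apply, Pi.neg_apply]
  ring

theorem coeff_quadratic (x y : Fun τ) (k : ℕ) (hk : 2 < k) :
    PowerSeries.coeff k ((1 - PowerSeries.C x * PowerSeries.X) *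
      (1 - PowerSeries.C y * PowerSeries.X)) = 0 := by
  obtain ⟨k, rfl⟩ : ∃ j, k = j + 3 := ⟨k - 3, by omega⟩
  have : (1 - PowerSeries.C x * PowerSeries.X) * (1 - PowerSeries.C y * PowerSeries.X) =
      1 - PowerSeries.C (x + y) * PowerSeries.X +
        PowerSeries.C (x * y) * PowerSeries.X * PowerSeries.X := by
    rw [map_add, map_mul]; ring
  rw [this]
  simp [PowerSeries.coeff_succ_mul_X, PowerSeries.coeff_one]

/-- For index difference `2` the right side is zero, and the second residue would need the `z³`
coefficient of a quadratic. Only the difference of the evaluations at `x` and `y` remains. -/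
theorem AmplitudeBilinear.symmetric (h : AmplitudeBilinear P Q) (hp₁ : HasSubst p₁)
    (hp₂ : HasSubst p₂) {x y : Fun τ} (hx : constantCoeff x = 0) (hy : constantCoeff y = 0)
    (hxy : ∀ k, p₁ k - p₂ k = bracket x k + bracket y k) (n : ℤ) :
    evalOpt hp₁ hx (amp P (n + 1)) * evalOpt hp₂ hx (amp Q (n - 1)) =
      evalOpt hp₁ hy (amp P (n + 1)) * evalOpt hp₂ hy (amp Q (n - 1)) := by
  have hs := hasSubst_sumElim hp₁ hp₂
  have h1 := residue_pole lowWeight_expXi_sub hs hx hy (fun k => by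
    rw [map_kernel hp₁ hp₂ hxy, coeff_expXi_bracket_add]) 0 ((optionEquivLeft _ ℂ).symm
      (PowerSeries.map at₁.toRingHom (P (n + 1)) * PowerSeries.map at₂.toRingHom (Q (n - 1))))
  have h2 := residue_polynomial lowWeight_expXi_neg_sub hs 2 (fun k hk => by
    rw [map_neg_kernel hp₁ hp₂ hxy, coeff_quadratic x y k (by omega)])
    ((optionEquivLeft _ ℂ).symm
      (PowerSeries.map at₁.toRingHom (Q (n + 1)) * PowerSeries.map at₂.toRingHom (P (n - 1))))
  rw [map_neg_kernel hp₁ hp₂ hxy, coeff_quadratic x y _ (by omega), zero_mul] at h2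
  have h3 := congrArg (substAlgHom (R := ℂ) hs) (h (n + 1) (n - 1))
  rw [show n + 1 - (n - 1) = 2 by ring, show n - 1 - (n + 1) = -2 by ring, map_add] at h3
  simp only [Nat.cast_zero, sub_zero, Nat.cast_ofNat, AlgEquiv.apply_symm_apply, pow_zero,
    one_mul] at h1 h2
  rw [h2, add_zero] at h3
  rw [h3, evalOpt_mul_at hp₁ hp₂, evalOpt_mul_at hp₁ hp₂] at h1
  rw [show ((1 - (-1 : ℂ) ^ (2 : ℤ)) / 2) = 0 by norm_num, map_zero, map_zero, mul_zero] at h1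
  exact (sub_eq_zero.mp h1.symm)

/-- For index difference `1` and `y = 0`, the second residue needs the `z²` coefficient of `1 - xz`,
and the right side is `1`. -/
theorem AmplitudeBilinear.mul_eq_one (h : AmplitudeBilinear P Q) (hp₁ : HasSubst p₁)
    (hp₂ : HasSubst p₂) {x : Fun τ} (hx : constantCoeff x = 0) (hx0 : x ≠ 0)
    (hxy : ∀ k, p₁ k - p₂ k = bracket x k) (n : ℤ) :
    evalOpt hp₁ hx (amp P (n + 1)) * evalOpt hp₂ hx (amp Q n) = 1 := by
  have hs := hasSubst_sumElim hp₁ hp₂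
  have hxy' : ∀ k, p₁ k - p₂ k = bracket x k + bracket 0 k := fun k => by simp [hxy, bracket_zero]
  have h1 := residue_pole lowWeight_expXi_sub hs hx (map_zero constantCoeff) (fun k => by
    rw [map_kernel hp₁ hp₂ hxy', coeff_expXi_bracket_add]) 1 ((optionEquivLeft _ ℂ).symm
      (PowerSeries.map at₁.toRingHom (P (n + 1)) * PowerSeries.map at₂.toRingHom (Q n)))
  have h2 := residue_polynomial lowWeight_expXi_neg_sub hs 1 (fun k hk => by
    rw [map_neg_kernel hp₁ hp₂ hxy', coeff_quadratic x 0 k (by omega)])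
    ((optionEquivLeft _ ℂ).symm
      (PowerSeries.map at₁.toRingHom (Q (n + 1)) * PowerSeries.map at₂.toRingHom (P n)))
  have hc : PowerSeries.coeff (1 + 1) ((1 - PowerSeries.C x * PowerSeries.X) *
      (1 - PowerSeries.C (0 : Fun τ) * PowerSeries.X)) = 0 := by
    simp [PowerSeries.coeff_succ_mul_X, PowerSeries.coeff_one]
  rw [map_neg_kernel hp₁ hp₂ hxy', hc, zero_mul] at h2
  have h3 := congrArg (substAlgHom (R := ℂ) hs) (h (n + 1) n)
  rw [show n + 1 - n = 1 by ring, show n - (n + 1) = -1 by ring, map_add] at h3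
  simp only [Nat.cast_one, AlgEquiv.apply_symm_apply, pow_one, zero_mul, sub_zero] at h1 h2
  rw [show (2 - 1 : ℤ) = 1 by norm_num] at h1
  rw [h2, add_zero] at h3
  rw [h3, evalOpt_mul_at hp₁ hp₂, show ((1 - (-1 : ℂ) ^ (1 : ℤ)) / 2) = 1 by norm_num, map_one,
    map_one] at h1
  exact (mul_left_cancel₀ hx0 h1).symm

/-- For equal indices and `y = 0`, the second residue picks the coefficient `-x` of `1 - xz` and so
contributes the leading coefficients. -/
theorem AmplitudeBilinear.mul_eq_leading (h : AmplitudeBilinear P Q) (hp₁ : HasSubst p₁)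
    (hp₂ : HasSubst p₂) {x : Fun τ} (hx : constantCoeff x = 0) (hx0 : x ≠ 0)
    (hxy : ∀ k, p₁ k - p₂ k = bracket x k) (n : ℤ) :
    evalOpt hp₁ hx (amp P n) * evalOpt hp₂ hx (amp Q n) =
      substAlgHom hp₁ (PowerSeries.constantCoeff (Q n)) *
        substAlgHom hp₂ (PowerSeries.constantCoeff (P n)) := by
  have hs := hasSubst_sumElim hp₁ hp₂
  have hxy' : ∀ k, p₁ k - p₂ k = bracket x k + bracket 0 k := fun k => by simp [hxy, bracket_zero]
  have h1 := residue_pole lowWeight_expXi_sub hs hx (map_zero constantCoeff) (fun k => by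
    rw [map_kernel hp₁ hp₂ hxy', coeff_expXi_bracket_add]) 2 ((optionEquivLeft _ ℂ).symm
      (PowerSeries.map at₁.toRingHom (P n) * PowerSeries.map at₂.toRingHom (Q n)))
  have hc : PowerSeries.coeff (0 + 1) ((1 - PowerSeries.C x * PowerSeries.X) *
      (1 - PowerSeries.C (0 : Fun τ) * PowerSeries.X)) = -x := by
    simp [PowerSeries.coeff_succ_mul_X, PowerSeries.coeff_one]
  have h2 := residue_polynomial lowWeight_expXi_neg_sub hs 0 (fun k hk => by
    rw [map_neg_kernel hp₁ hp₂ hxy']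
    obtain ⟨k, rfl⟩ : ∃ j, k = j + 2 := ⟨k - 2, by omega⟩
    simp [PowerSeries.coeff_succ_mul_X, PowerSeries.coeff_one])
    ((optionEquivLeft _ ℂ).symm
      (PowerSeries.map at₁.toRingHom (Q n) * PowerSeries.map at₂.toRingHom (P n)))
  rw [map_neg_kernel hp₁ hp₂ hxy', hc, evalOpt_mul_at hp₁ hp₂, evalOpt_zero, evalOpt_zero] at h2
  have h3 := congrArg (substAlgHom (R := ℂ) hs) (h n n)
  rw [sub_self, map_add] at h3
  simp only [Nat.cast_ofNat, Nat.cast_zero, neg_zero, AlgEquiv.apply_symm_apply, sub_self,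
    sub_zero, evalOpt_mul_at hp₁ hp₂, ne_eq, OfNat.ofNat_ne_zero, not_false_eq_true, zero_pow, zero_mul,
    zpow_zero, zero_div, map_zero] at h1 h2 h3
  -- One factor `x` is the `x - y` of the partial fractions; the other is present in both residues.
  refine mul_left_cancel₀ (mul_ne_zero hx0 hx0) ?_
  unfold amp
  linear_combination -h1 + x * h3 - x * h2

end Substituted

/-! ### The derivation that annihilates Miwa shifts -/

section MiwaDerivation

variable {σ τ : Type}

theorem pderiv_algHom {Φ : Fun σ →ₐ[ℂ] Fun τ} (hΦ : FinDet Φ) {s : σ} {r : τ}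
    (h : ∀ a, pderiv ℂ r (Φ (X a)) = Φ (pderiv ℂ s (X a))) (f : Fun σ) :
    pderiv ℂ r (Φ f) = Φ (pderiv ℂ s f) := by
  refine FinDet.ext_polynomial ((FinDet.pderiv r).comp hΦ) (hΦ.comp (FinDet.pderiv s))
    (fun p => ?_) f
  induction p using MvPolynomial.induction_on with
  | C c =>
    have : Φ (C c) = C c := Φ.commutes c
    simp [this]
  | add p q hp hq => simp only [MvPolynomial.coe_add, map_add, hp, hq]
  | mul_X p a hp =>
    simp only [MvPolynomial.coe_mul, MvPolynomial.coe_X, map_mul, Derivation.leibniz, smul_eq_mul,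
      hp, h, map_add]

theorem coeff_X_pow_mul_of_lt {s : σ} {i : ℕ} {d : σ →₀ ℕ} (h : d s < i) (F : Fun σ) :
    coeff d (X s ^ i * F) = 0 := by
  classical
  rw [X_pow_eq, coeff_monomial_mul, if_neg]
  intro hle
  have := hle s
  simp at this
  omega

/-- The partial sums of `∂_u + ∑_{i ≥ 0} u^i ∂_{e i}`. -/
noncomputable def miwaDerivAux (e : ℕ → σ) (K : ℕ) :
    Derivation ℂ (Fun (Option σ)) (Fun (Option σ)) :=
  pderiv ℂ none + ∑ i ∈ Finset.range K, (X none : Fun (Option σ)) ^ i • pderiv ℂ (some (e i))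

theorem miwaDerivAux_apply (e : ℕ → σ) (K : ℕ) (F : Fun (Option σ)) :
    miwaDerivAux e K F =
      pderiv ℂ none F + ∑ i ∈ Finset.range K, X none ^ i * pderiv ℂ (some (e i)) F := by
  simp only [miwaDerivAux, Derivation.add_apply, ← Derivation.coeFnAddMonoidHom_apply, map_sum,
    Finset.sum_apply]
  rfl

/-- A summand with `u^i` cannot reach a monomial of smaller `u`-degree, so the partial sums
stabilize at each monomial and the infinite sum can be read off there. -/
theorem coeff_miwaDerivAux (e : ℕ → σ) {K : ℕ} (F : Fun (Option σ)) {d : Option σ →₀ ℕ}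
    (h : d none < K) : coeff d (miwaDerivAux e K F) = coeff d (miwaDerivAux e (d none + 1) F) := by
  rw [miwaDerivAux_apply, miwaDerivAux_apply, map_add, map_add, map_sum, map_sum]
  congr 1
  refine (Finset.sum_subset (Finset.range_subset_range.mpr h) fun i _ hi => ?_).symm
  exact coeff_X_pow_mul_of_lt (by simpa using hi) _

/-- The linear map `∂_u + ∑_{i ≥ 0} u^i ∂_{e i}`. -/
noncomputable def miwaDerivLin (e : ℕ → σ) : Fun (Option σ) →ₗ[ℂ] Fun (Option σ) where
  toFun F := fun d => coeff d (miwaDerivAux e (d none + 1) F)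
  map_add' F G := funext fun d => by rw [map_add, map_add]; rfl
  map_smul' c F := funext fun d => by rw [Derivation.map_smul, map_smul]; rfl

theorem coeff_miwaDerivLin (e : ℕ → σ) (F : Fun (Option σ)) (d : Option σ →₀ ℕ) :
    coeff d (miwaDerivLin e F) = coeff d (miwaDerivAux e (d none + 1) F) := rfl

/-- The derivation `∂_u + ∑_{i ≥ 0} u^i ∂_{e i}`, where `u` is the additional variable. -/
noncomputable def miwaDeriv (e : ℕ → σ) : Derivation ℂ (Fun (Option σ)) (Fun (Option σ)) :=
  Derivation.mk' (miwaDerivLin e) fun F G => by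
    classical
    ext d
    rw [coeff_miwaDerivLin, Derivation.leibniz, map_add, map_add, smul_eq_mul, smul_eq_mul,
      smul_eq_mul, smul_eq_mul, coeff_mul, coeff_mul, coeff_mul, coeff_mul]
    -- The factors of a monomial have `u`-degree at most that of `d`, so the truncation chosen for
    -- `d` is valid for them too.
    congr 1 <;>
    · refine Finset.sum_congr rfl fun q hq => ?_
      rw [coeff_miwaDerivLin, coeff_miwaDerivAux e _ (lt_of_le_of_lt _ (Nat.lt_succ_self (d none)))]
      have := DFunLike.congr_fun (Finset.HasAntidiagonal.mem_antidiagonal.mp hq) none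
      rw [Finsupp.add_apply] at this
      omega

theorem coeff_miwaDeriv (e : ℕ → σ) (F : Fun (Option σ)) (d : Option σ →₀ ℕ) :
    coeff d (miwaDeriv e F) = coeff d (miwaDerivAux e (d none + 1) F) := rfl

theorem finDet_miwaDeriv (e : ℕ → σ) : FinDet (miwaDeriv e) := by
  have h : ∀ K, FinDet (miwaDerivAux e K) := by
    intro K
    have h2 : FinDet fun F : Fun (Option σ) =>
        ∑ i ∈ Finset.range K, X none ^ i * pderiv ℂ (some (e i)) F := by
      induction K with
      | zero => simpa using FinDet.const 0
      | succ K ih =>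
        simp_rw [Finset.sum_range_succ]
        exact ih.add ((FinDet.const _).mul (FinDet.pderiv _))
    have h3 := (FinDet.pderiv (R := ℂ) (none : Option σ)).add h2
    intro d
    obtain ⟨D, hD⟩ := h3 d
    refine ⟨D, fun f g hfg => ?_⟩
    rw [miwaDerivAux_apply, miwaDerivAux_apply]
    exact hD f g hfg
  intro d
  obtain ⟨D, hD⟩ := h (d none + 1) d
  exact ⟨D, fun f g hfg => by rw [coeff_miwaDeriv, coeff_miwaDeriv]; exact hD f g hfg⟩

theorem coeff_optionEquivLeft_pderiv_some (s : σ) (F : Fun (Option σ)) (n : ℕ) :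
    PowerSeries.coeff n (optionEquivLeft σ ℂ (pderiv ℂ (some s) F)) =
      pderiv ℂ s (PowerSeries.coeff n (optionEquivLeft σ ℂ F)) := by
  classical
  ext d
  rw [coeff_coeff_optionEquivLeft, coeff_pderiv, coeff_pderiv, coeff_coeff_optionEquivLeft,
    Finsupp.optionElim_apply_some]
  congr 3
  ext o
  cases o with
  | none => simp
  | some a => simp [Finsupp.single_apply]

theorem coeff_optionEquivLeft_pderiv_none (F : Fun (Option σ)) (n : ℕ) :
    PowerSeries.coeff n (optionEquivLeft σ ℂ (pderiv ℂ none F)) =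
      ((n : Fun σ) + 1) * PowerSeries.coeff (n + 1) (optionEquivLeft σ ℂ F) := by
  classical
  ext d
  rw [coeff_coeff_optionEquivLeft, coeff_pderiv, Finsupp.optionElim_apply_none,
    show ((n : Fun σ) + 1) = C ((n : ℂ) + 1) by simp, coeff_C_mul, coeff_coeff_optionEquivLeft,
    mul_comm]
  congr 3
  ext o
  cases o with
  | none => simp
  | some a => simp

theorem coeff_optionEquivLeft_miwaDeriv (e : ℕ → σ) (F : Fun (Option σ)) (n : ℕ) :
    PowerSeries.coeff n (optionEquivLeft σ ℂ (miwaDeriv e F)) =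
      ((n : Fun σ) + 1) * PowerSeries.coeff (n + 1) (optionEquivLeft σ ℂ F) +
        ∑ i ∈ Finset.range (n + 1),
          pderiv ℂ (e i) (PowerSeries.coeff (n - i) (optionEquivLeft σ ℂ F)) := by
  have h : PowerSeries.coeff n (optionEquivLeft σ ℂ (miwaDeriv e F)) =
      PowerSeries.coeff n (optionEquivLeft σ ℂ (miwaDerivAux e (n + 1) F)) := by
    ext d
    rw [coeff_coeff_optionEquivLeft, coeff_coeff_optionEquivLeft, coeff_miwaDeriv,
      Finsupp.optionElim_apply_none]
  rw [h, miwaDerivAux_apply, map_add, map_add, coeff_optionEquivLeft_pderiv_none, map_sum, map_sum]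
  congr 1
  refine Finset.sum_congr rfl fun i hi => ?_
  rw [map_mul, map_pow, optionEquivLeft_X_none, PowerSeries.coeff_X_pow_mul',
    if_pos (Nat.lt_succ_iff.mp (Finset.mem_range.mp hi)), coeff_optionEquivLeft_pderiv_some]

theorem optionEquivLeft_ext {F G : Fun (Option σ)}
    (h : ∀ n, PowerSeries.coeff n (optionEquivLeft σ ℂ F) =
      PowerSeries.coeff n (optionEquivLeft σ ℂ G)) : F = G :=
  (optionEquivLeft σ ℂ).injective (PowerSeries.ext h)

theorem coeff_miwaDeriv_incl (e : ℕ → σ) (f : Fun σ) (n : ℕ) :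
    PowerSeries.coeff n (optionEquivLeft σ ℂ (miwaDeriv e (incl σ f))) = pderiv ℂ (e n) f := by
  rw [coeff_optionEquivLeft_miwaDeriv, optionEquivLeft_incl, PowerSeries.coeff_succ_C, mul_zero,
    zero_add, Finset.sum_range_succ, Nat.sub_self, PowerSeries.coeff_zero_C,
    Finset.sum_eq_zero, zero_add]
  intro i hi
  rw [PowerSeries.coeff_C, if_neg (by have := Finset.mem_range.mp hi; omega), map_zero]

theorem miwaDeriv_optionMap {e : ℕ → σ} {e' : ℕ → τ} {Φ : Fun σ →ₐ[ℂ] Fun τ}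
    (h : ∀ i f, pderiv ℂ (e' i) (Φ f) = Φ (pderiv ℂ (e i) f)) (F : Fun (Option σ)) :
    miwaDeriv e' (optionMap Φ F) = optionMap Φ (miwaDeriv e F) := by
  refine optionEquivLeft_ext fun n => ?_
  have hc : ∀ F n, PowerSeries.coeff n (optionEquivLeft τ ℂ (optionMap Φ F)) =
      Φ (PowerSeries.coeff n (optionEquivLeft σ ℂ F)) := fun F n => by
    rw [optionEquivLeft_optionMap, PowerSeries.coeff_map]; rfl
  rw [coeff_optionEquivLeft_miwaDeriv, hc, hc, coeff_optionEquivLeft_miwaDeriv, map_add, map_mul,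
    map_sum]
  simp only [hc, h, map_add, map_natCast, map_one]

theorem miwaDeriv_algHom_eq_zero {e : ℕ → σ} {Φ : Fun τ →ₐ[ℂ] Fun (Option σ)} (hΦ : FinDet Φ)
    (h : ∀ a, miwaDeriv e (Φ (X a)) = 0) (f : Fun τ) : miwaDeriv e (Φ f) = 0 := by
  refine FinDet.ext_polynomial ((finDet_miwaDeriv e).comp hΦ) (FinDet.const 0) (fun p => ?_) f
  induction p using MvPolynomial.induction_on with
  | C c =>
    have : Φ (C c) = algebraMap ℂ _ c := Φ.commutes c
    rw [MvPolynomial.coe_C, this, Derivation.map_algebraMap]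
  | add p q hp hq => rw [MvPolynomial.coe_add, map_add, map_add, hp, hq, add_zero]
  | mul_X p a hp =>
    rw [MvPolynomial.coe_mul, MvPolynomial.coe_X, map_mul, Derivation.leibniz, hp, h, smul_zero,
      smul_zero, add_zero]

theorem pderiv_miwaDeriv {e : ℕ → σ} (s : σ)
    (F : Fun (Option σ)) :
    pderiv ℂ (some s) (miwaDeriv e F) = miwaDeriv e (pderiv ℂ (some s) F) := by
  have hcomm : ∀ (a b : σ) (f : Fun σ), pderiv ℂ a (pderiv ℂ b f) = pderiv ℂ b (pderiv ℂ a f) := by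
    classical
    intro a b f
    ext d
    simp only [coeff_pderiv, Finsupp.add_apply]
    rw [add_right_comm]
    by_cases hab : a = b
    · subst hab; rfl
    · simp [hab, Ne.symm hab]
      ring
  refine optionEquivLeft_ext fun n => ?_
  rw [coeff_optionEquivLeft_pderiv_some, coeff_optionEquivLeft_miwaDeriv,
    coeff_optionEquivLeft_miwaDeriv, map_add, map_sum, Derivation.leibniz]
  simp only [coeff_optionEquivLeft_pderiv_some, hcomm s]
  simp

/-- The coefficient of `u^n` in the equation expresses `(n+1) F_{n+1}` through derivatives of `F_0,
…, F_n`, so the value at `u = 0` determines `F`. -/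
theorem eq_zero_of_miwaDeriv_eq_zero {e : ℕ → σ} {F : Fun (Option σ)} (h : miwaDeriv e F = 0)
    (h0 : PowerSeries.coeff 0 (optionEquivLeft σ ℂ F) = 0) : F = 0 := by
  refine optionEquivLeft_ext fun n => ?_
  rw [map_zero, map_zero]
  induction n using Nat.strong_induction_on with
  | _ n ih =>
    cases n with
    | zero => exact h0
    | succ n =>
      have h1 := coeff_optionEquivLeft_miwaDeriv e F n
      rw [h, map_zero, map_zero, Finset.sum_eq_zero, add_zero] at h1
      · refine (mul_eq_zero.mp h1.symm).resolve_left ?_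
        rw [show ((n : Fun σ) + 1) = C ((n : ℂ) + 1) by simp]
        intro h2
        have h3 := congrArg constantCoeff h2
        rw [constantCoeff_C, map_zero] at h3
        exact Nat.cast_add_one_ne_zero n h3
      · intro i _
        rw [ih (n - i) (by omega), map_zero]

end MiwaDerivation

/-! ### Formal Poincaré lemma -/

/-- A closed formal `1`-form is exact. -/
theorem exists_potential {σ : Type} (ω : σ → Fun σ)
    (h : ∀ i j, pderiv ℂ i (ω j) = pderiv ℂ j (ω i)) :
    ∃ f : Fun σ, constantCoeff f = 0 ∧ ∀ k, pderiv ℂ k f = ω k := by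
  classical
  -- Each monomial is integrated along an arbitrarily chosen variable occurring in it; closedness
  -- makes the result independent of the choice.
  let f : Fun σ := fun d => if hd : d.support.Nonempty then
    coeff (d - Finsupp.single hd.choose 1) (ω hd.choose) / (d hd.choose : ℂ) else 0
  refine ⟨f, ?_, fun k => ext fun d => ?_⟩
  · change f 0 = 0
    simp [f]
  · rw [coeff_pderiv]
    have hd : (d + Finsupp.single k 1).support.Nonempty := ⟨k, by simp⟩
    have hf : coeff (d + Finsupp.single k 1) f =
      coeff (d + Finsupp.single k 1 - Finsupp.single hd.choose 1) (ω hd.choose) /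
        ((d + Finsupp.single k 1 : σ →₀ ℕ) hd.choose : ℂ) := dif_pos hd
    rw [hf]
    have hj := hd.choose_spec
    generalize hd.choose = j at hj ⊢
    rw [Finsupp.mem_support_iff] at hj
    by_cases hjk : j = k
    · subst hjk
      rw [add_tsub_cancel_right]
      have : ((d + Finsupp.single j 1 : σ →₀ ℕ) j : ℂ) = (d j : ℂ) + 1 := by simp
      rw [this, div_mul_cancel₀ _ (Nat.cast_add_one_ne_zero (d j))]
    · have hdj : d j ≠ 0 := by simpa [Finsupp.single_apply, Ne.symm hjk] using hj
      obtain ⟨c, rfl⟩ : ∃ c, d = c + Finsupp.single j 1 := ⟨d - Finsupp.single j 1, by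
        ext a
        by_cases ha : j = a
        · subst ha; simp; omega
        · simp [ha]⟩
      have h1 := congrArg (coeff c) (h j k)
      rw [coeff_pderiv, coeff_pderiv] at h1
      rw [add_right_comm, add_tsub_cancel_right]
      have e1 : ((c + Finsupp.single k 1 + Finsupp.single j 1 : σ →₀ ℕ) j : ℂ) = (c j : ℂ) + 1 := by
        simp [Ne.symm hjk]
      have e2 : ((c + Finsupp.single j 1 : σ →₀ ℕ) k : ℂ) = c k := by
        simp [hjk]
      rw [e1, e2, div_mul_eq_mul_div, ← h1, mul_div_assoc,
        div_self (Nat.cast_add_one_ne_zero (c j)), mul_one]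

/-- A closed formal `1`-form is the logarithmic derivative of a formal power series. -/
theorem exists_logPotential {σ : Type} (ω : σ → Fun σ)
    (h : ∀ i j, pderiv ℂ i (ω j) = pderiv ℂ j (ω i)) :
    ∃ f : Fun σ, constantCoeff f ≠ 0 ∧ ∀ k, pderiv ℂ k f = ω k * f := by
  obtain ⟨g, hg0, hg⟩ := exists_potential ω h
  have hs : PowerSeries.HasSubst g := PowerSeries.HasSubst.of_constantCoeff_zero hg0
  refine ⟨(PowerSeries.exp ℂ).subst g, ?_, fun k => ?_⟩
  · rw [PowerSeries.constantCoeff_subst hs, finsum_eq_single _ 0]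
    · simp
    · intro n hn
      simp [hg0, hn]
  · rw [pderiv_subst hs, PowerSeries.derivative_exp, hg, mul_comm]

/-! ### Miwa shifts as substitutions -/

section Shifts

theorem HasSubst.sub {σ τ : Type} {a b : σ → Fun τ} (ha : HasSubst a) (hb : HasSubst b) :
    HasSubst (a - b) := by
  rw [sub_eq_add_neg, ← mul_neg_one, mul_comm]
  exact ha.add (hb.mul_left _)

theorem hasSubst_X_comp {σ τ : Type} {j : σ → τ} (hj : Function.Injective j) :
    HasSubst (fun k => (X (j k) : Fun τ)) where
  const_coeff k := by simp
  coeff_zero d := by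
    classical
    refine Set.Subsingleton.finite fun a ha b hb => ?_
    simp only [Set.mem_ofPred_eq, coeff_X, ne_eq, ite_eq_right_iff, one_ne_zero, imp_false,
      not_not] at ha hb
    exact hj ((Finsupp.single_left_inj one_ne_zero).mp (ha.symm.trans hb))

theorem hasSubst_bracket {τ : Type} (s : τ) : HasSubst (bracket (X s : Fun τ)) where
  const_coeff k := by simp [bracket]
  coeff_zero d := by
    classical
    refine Set.Subsingleton.finite fun a ha b hb => ?_
    have key : ∀ k : ℕ+, coeff d (bracket (X s : Fun τ) k) ≠ 0 →
        d = Finsupp.single s (k : ℕ) := by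
      intro k hk
      by_contra h
      exact hk (by rw [bracket, coeff_C_mul, coeff_X_pow, if_neg h, mul_zero])
    have h := (key a ha).symm.trans (key b hb)
    exact PNat.coe_injective (by simpa using DFunLike.congr_fun h s)

theorem X_ne_zero {σ : Type} (s : σ) : (X s : Fun σ) ≠ 0 := fun h => by
  simpa [coeff_X] using congrArg (coeff (Finsupp.single s 1)) h

theorem substAlgHom_X_eq {σ : Type} (f : Fun σ) :
    substAlgHom (R := ℂ) (HasSubst.X (σ := σ) (S := ℂ)) f = f := by
  rw [substAlgHom_apply, subst_self, id]

theorem evalOpt_self {σ : Type} (hj : HasSubst fun k : σ => (X (some k) : Fun (Option σ)))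
    (F : Fun (Option σ)) : evalOpt hj (constantCoeff_X none) F = F := by
  suffices h : evalOpt hj (constantCoeff_X none) = AlgHom.id ℂ _ from DFunLike.congr_fun h F
  refine FinDet.ext_algHom (finDet_evalOpt _ _) (fun e => ⟨{e}, fun f g h => h e (by simp)⟩)
    fun o => ?_
  cases o with
  | none => exact evalOpt_X_none _ _
  | some s => exact evalOpt_X_some _ _ s

theorem constantCoeff_optionEquivLeft {σ : Type} (F : Fun (Option σ)) :
    PowerSeries.constantCoeff (optionEquivLeft σ ℂ F) =
      evalOpt HasSubst.X (map_zero constantCoeff) F := by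
  have := evalOpt_zero HasSubst.X (optionEquivLeft σ ℂ F)
  rw [AlgEquiv.symm_apply_apply, substAlgHom_X_eq] at this
  exact this.symm

/-- The Miwa shift `f(t) ↦ f(t + ε [u])`. -/
noncomputable def shift (ε : ℂ) : Fun ℕ+ →ₐ[ℂ] Fun (Option ℕ+) :=
  substAlgHom (miwaArg_hasSubst ε)

theorem miwa_eq (ε : ℂ) (f : Fun ℕ+) : miwa ε f = optionEquivLeft ℕ+ ℂ (shift ε f) := by
  rw [miwa, shift, coe_substAlgHom]

theorem shift_X (ε : ℂ) (k : ℕ+) : shift ε (X k) = miwaArg ε k := substAlgHom_X _ _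

theorem finDet_shift (ε : ℂ) : FinDet (shift ε) := finDet_substAlgHom _

theorem miwaArg_eq (ε : ℂ) (k : ℕ+) :
    miwaArg ε k = X (some k) + C ε * bracket (X none) k := by
  rw [miwaArg, bracket, ← mul_assoc, ← map_mul, mul_one_div]

/-- The substitution `t ↦ t + ε [u]`, `u ↦ u`. -/
noncomputable def fullShift (ε : ℂ) : Fun (Option ℕ+) →ₐ[ℂ] Fun (Option ℕ+) :=
  evalOpt (miwaArg_hasSubst ε) (constantCoeff_X none)

theorem fullShift_incl (ε : ℂ) (f : Fun ℕ+) : fullShift ε (incl ℕ+ f) = shift ε f :=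
  evalOpt_incl _ _ f

theorem fullShift_fullShift_neg (F : Fun (Option ℕ+)) : fullShift 1 (fullShift (-1) F) = F := by
  have hj := hasSubst_X_comp (Option.some_injective ℕ+)
  rw [fullShift, fullShift, algHom_evalOpt _ _ (finDet_evalOpt _ _) hj (constantCoeff_X none),
    evalOpt_self]
  · intro k
    rw [miwaArg_eq, map_add, evalOpt_X_some, bracket, map_mul, map_mul, map_pow, evalOpt_X_none,
      miwaArg_eq, bracket]
    have hC : ∀ c : ℂ, evalOpt (miwaArg_hasSubst 1) (constantCoeff_X none) (C c) = C c :=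
      fun c => AlgHom.commutes _ c
    rw [hC, hC, map_neg, map_one]
    ring
  · exact evalOpt_X_none _ _

theorem constantCoeff_optionEquivLeft_fullShift (ε : ℂ) (F : Fun (Option ℕ+)) :
    PowerSeries.constantCoeff (optionEquivLeft ℕ+ ℂ (fullShift ε F)) =
      PowerSeries.constantCoeff (optionEquivLeft ℕ+ ℂ F) := by
  rw [constantCoeff_optionEquivLeft, constantCoeff_optionEquivLeft, fullShift]
  refine algHom_evalOpt _ _ (finDet_evalOpt _ _) _ _ (fun k => ?_) (evalOpt_X_none _ _) F
  rw [miwaArg_eq, map_add, evalOpt_X_some, bracket, map_mul, map_mul, map_pow, evalOpt_X_none,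
    zero_pow k.ne_zero]
  simp

theorem constantCoeff_optionEquivLeft_shift (ε : ℂ) (f : Fun ℕ+) :
    PowerSeries.constantCoeff (optionEquivLeft ℕ+ ℂ (shift ε f)) = f := by
  rw [← fullShift_incl, constantCoeff_optionEquivLeft_fullShift, optionEquivLeft_incl,
    PowerSeries.constantCoeff_C]

end Shifts

/-! ### Relations between amplitudes, and the cocycle condition -/

section Amplitudes

variable {P Q : ℤ → PowerSeries (Fun ℕ+)}

theorem optionEquivLeft_amp (n : ℤ) : optionEquivLeft ℕ+ ℂ (amp P n) = P n :=
  AlgEquiv.apply_symm_apply _ _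

theorem X_sub_miwaArg (k : ℕ+) : X (some k) - miwaArg (-1) k = bracket (X none) k := by
  rw [miwaArg_eq, map_neg, map_one]
  ring

theorem AmplitudeBilinear.amp_mul_fullShift (h : AmplitudeBilinear P Q) (n : ℤ) :
    amp P (n + 1) * fullShift (-1) (amp Q n) = 1 := by
  have := h.mul_eq_one (hasSubst_X_comp (Option.some_injective ℕ+)) (miwaArg_hasSubst (-1))
    (constantCoeff_X none) (X_ne_zero none) X_sub_miwaArg n
  rwa [evalOpt_self] at this

theorem AmplitudeBilinear.leading_mul_leading (h : AmplitudeBilinear P Q) (n : ℤ) :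
    PowerSeries.constantCoeff (P (n + 1)) * PowerSeries.constantCoeff (Q n) = 1 := by
  have := congrArg (fun F => PowerSeries.constantCoeff (optionEquivLeft ℕ+ ℂ F))
    (h.amp_mul_fullShift n)
  simpa only [map_mul, map_one, constantCoeff_optionEquivLeft_fullShift, optionEquivLeft_amp]
    using this

/-- Both `P_n` and `P_{n+1}` are known multiples of the inverse of `Q_n(t-[x],x)`; eliminating it
compares consecutive amplitudes. -/
theorem AmplitudeBilinear.amp_eq (h : AmplitudeBilinear P Q) (n : ℤ) :
    amp P n = amp P (n + 1) * (incl ℕ+ (PowerSeries.constantCoeff (Q n)) *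
      shift (-1) (PowerSeries.constantCoeff (P n))) := by
  have h1 := h.mul_eq_leading (hasSubst_X_comp (Option.some_injective ℕ+)) (miwaArg_hasSubst (-1))
    (constantCoeff_X none) (X_ne_zero none) X_sub_miwaArg n
  have h2 := h.amp_mul_fullShift n
  rw [evalOpt_self, ← evalOpt_incl _ (constantCoeff_X none), evalOpt_self] at h1
  change amp P n * fullShift (-1) (amp Q n) = _ * shift (-1) _ at h1
  linear_combination (-amp P n) * h2 + amp P (n + 1) * h1

/-- The additional variable `x`, in the ring with two additional variables `x` and `y`. -/
noncomputable def varX : Fun (Option (Option ℕ+)) := X (some none)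

/-- The additional variable `y`, in the ring with two additional variables `x` and `y`. -/
noncomputable def varY : Fun (Option (Option ℕ+)) := X none

/-- The times, in the ring with two additional variables. -/
noncomputable def tt (k : ℕ+) : Fun (Option (Option ℕ+)) := X (some (some k))

theorem hasSubst_tt : HasSubst tt :=
  hasSubst_X_comp ((Option.some_injective _).comp (Option.some_injective _))

theorem hasSubst_tt_sub_bracket_varX : HasSubst (tt - bracket varX) :=
  HasSubst.sub hasSubst_tt (hasSubst_bracket _)

theorem hasSubst_tt_sub_bracket_varY : HasSubst (tt - bracket varY) :=
  HasSubst.sub hasSubst_tt (hasSubst_bracket _)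

theorem hasSubst_tt_sub_bracket_sub_bracket : HasSubst (tt - bracket varX - bracket varY) :=
  HasSubst.sub hasSubst_tt_sub_bracket_varX (hasSubst_bracket _)

theorem constantCoeff_varX : constantCoeff varX = 0 := constantCoeff_X _

theorem constantCoeff_varY : constantCoeff varY = 0 := constantCoeff_X _

/-- The residue relations speak of evaluations, while the derivations act well on `incl` and
`optionMap`. This lemma and its companions translate; the outer `none` is `y`, the inner one `x`. -/
theorem evalOpt_tt_varX (F : Fun (Option ℕ+)) :
    evalOpt hasSubst_tt constantCoeff_varX F = incl (Option ℕ+) F := by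
  suffices h : evalOpt hasSubst_tt constantCoeff_varX = incl (Option ℕ+) from
    DFunLike.congr_fun h F
  refine FinDet.ext_algHom (finDet_evalOpt _ _) finDet_incl fun o => ?_
  rw [incl_X]
  cases o with
  | none => exact evalOpt_X_none _ _
  | some k => exact evalOpt_X_some _ _ k

theorem evalOpt_tt_varY (F : Fun (Option ℕ+)) :
    evalOpt hasSubst_tt constantCoeff_varY F = optionMap (incl ℕ+) F := by
  suffices h : evalOpt hasSubst_tt constantCoeff_varY = optionMap (incl ℕ+) from
    DFunLike.congr_fun h F
  refine FinDet.ext_algHom (finDet_evalOpt _ _) (finDet_optionMap finDet_incl) fun o => ?_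
  cases o with
  | none => rw [optionMap_X_none]; exact evalOpt_X_none _ _
  | some k => rw [optionMap_X_some, incl_X, incl_X]; exact evalOpt_X_some _ _ k

theorem algHom_bracket {σ τ : Type} (Φ : Fun σ →ₐ[ℂ] Fun τ) (x : Fun σ) (k : ℕ+) :
    Φ (bracket x k) = bracket (Φ x) k := by
  have : Φ (C (1 / ((k : ℕ) : ℂ))) = C (1 / ((k : ℕ) : ℂ)) := Φ.commutes _
  rw [bracket, bracket, map_mul, map_pow, this]

theorem evalOpt_tt_sub_bracket_varX (F : Fun (Option ℕ+)) :
    evalOpt hasSubst_tt_sub_bracket_varX constantCoeff_varY F = optionMap (shift (-1)) F := by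
  suffices h : evalOpt hasSubst_tt_sub_bracket_varX constantCoeff_varY = optionMap (shift (-1)) from
    DFunLike.congr_fun h F
  refine FinDet.ext_algHom (finDet_evalOpt _ _) (finDet_optionMap (finDet_shift _)) fun o => ?_
  cases o with
  | none => rw [optionMap_X_none]; exact evalOpt_X_none _ _
  | some k =>
    rw [optionMap_X_some, evalOpt_X_some, shift_X, miwaArg_eq, map_add, incl_X, map_mul,
      algHom_bracket, incl_X, map_neg, map_one, map_neg, map_one]
    simp only [Pi.sub_apply, tt, varX]
    ring

/-- The substitution `t ↦ t - [y]`, `u ↦ x`. -/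
noncomputable def shiftY : Fun (Option ℕ+) →ₐ[ℂ] Fun (Option (Option ℕ+)) :=
  evalOpt hasSubst_tt_sub_bracket_varY constantCoeff_varX

theorem evalOpt_shift {τ : Type} {p : ℕ+ → Fun τ} (hp : HasSubst p) {v : Fun τ}
    (hv : constantCoeff v = 0) {q : ℕ+ → Fun τ} (hq : HasSubst q)
    (h : ∀ k, q k = p k - bracket v k) (f : Fun ℕ+) :
    evalOpt hp hv (shift (-1) f) = substAlgHom hq f := by
  refine algHom_substAlgHom _ (finDet_evalOpt hp hv) hq (fun k => ?_) f
  rw [miwaArg_eq, map_add, evalOpt_X_some, map_mul, algHom_bracket, evalOpt_X_none, h, map_neg,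
    map_neg, map_one, map_one]
  ring

/-- All three relations are used at `t'' = t-[x]-[y]`. There `Q_{n-1}` at `x` is inverse to
`P_n(t-[y],x)`, and at `y` to `P_n(t-[x],y)`; rewriting `P_n` through `P_{n+1}` turns the symmetry
of `P_{n+1} Q_{n-1}` in `x`, `y` into the cocycle condition. -/
theorem AmplitudeBilinear.commutation (h : AmplitudeBilinear P Q) (n : ℤ) {A : Fun (Option ℕ+)}
    (hA : A = incl ℕ+ (PowerSeries.constantCoeff (Q n)) * amp P (n + 1)) :
    incl (Option ℕ+) A * optionMap (shift (-1)) A =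
      optionMap (incl ℕ+) A * shiftY A := by
  rw [← evalOpt_tt_varX, ← evalOpt_tt_varY, ← evalOpt_tt_sub_bracket_varX, shiftY, hA]
  set F := PowerSeries.constantCoeff (Q n)
  set G := PowerSeries.constantCoeff (P n)
  simp only [map_mul, evalOpt_incl]
  have hsym := h.symmetric hasSubst_tt hasSubst_tt_sub_bracket_sub_bracket constantCoeff_varX
    constantCoeff_varY (fun k => by simp only [Pi.sub_apply]; ring) n
  have hx := h.mul_eq_one hasSubst_tt_sub_bracket_varY hasSubst_tt_sub_bracket_sub_bracket
    constantCoeff_varX (X_ne_zero _) (fun k => by simp only [Pi.sub_apply]; ring) (n - 1)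
  have hy := h.mul_eq_one hasSubst_tt_sub_bracket_varX hasSubst_tt_sub_bracket_sub_bracket
    constantCoeff_varY (X_ne_zero _) (fun k => by simp only [Pi.sub_apply]; ring) (n - 1)
  rw [sub_add_cancel, h.amp_eq n, map_mul, map_mul, evalOpt_incl] at hx hy
  rw [evalOpt_shift _ _ hasSubst_tt_sub_bracket_sub_bracket
    (fun k => by simp only [Pi.sub_apply]; ring)] at hx
  rw [evalOpt_shift _ _ hasSubst_tt_sub_bracket_sub_bracket (fun k => rfl)] at hy
  -- The factor `p_n(t-[x]-[y])` common to both relations is invertible, with inverse `q_{n-1}` at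
  -- the same times, and can be cancelled.
  have hunit : substAlgHom hasSubst_tt_sub_bracket_sub_bracket G *
      substAlgHom hasSubst_tt_sub_bracket_sub_bracket (PowerSeries.constantCoeff (Q (n - 1))) =
        1 := by
    rw [← map_mul, ← map_one (substAlgHom (R := ℂ) hasSubst_tt_sub_bracket_sub_bracket)]
    congr 1
    simpa using h.leading_mul_leading (n - 1)
  generalize substAlgHom hasSubst_tt_sub_bracket_sub_bracket
    (PowerSeries.constantCoeff (Q (n - 1))) = G' at hunit
  change _ * (_ * substAlgHom hasSubst_tt_sub_bracket_sub_bracket G) * _ = 1 at hx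
  change _ * (_ * substAlgHom hasSubst_tt_sub_bracket_sub_bracket G) * _ = 1 at hy
  generalize substAlgHom hasSubst_tt_sub_bracket_sub_bracket G = g at hunit hx hy
  generalize evalOpt hasSubst_tt constantCoeff_varX (amp P (n + 1)) = a at *
  generalize evalOpt hasSubst_tt constantCoeff_varY (amp P (n + 1)) = a' at *
  generalize evalOpt hasSubst_tt_sub_bracket_sub_bracket constantCoeff_varX (amp Q (n - 1)) = q at *
  generalize evalOpt hasSubst_tt_sub_bracket_sub_bracket constantCoeff_varY (amp Q (n - 1)) = q'
    at *
  generalize evalOpt hasSubst_tt_sub_bracket_varX constantCoeff_varY (amp P (n + 1)) = c at *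
  generalize evalOpt hasSubst_tt_sub_bracket_varY constantCoeff_varX (amp P (n + 1)) = c' at *
  change c' * (substAlgHom hasSubst_tt_sub_bracket_varY F * g) * q = 1 at hx
  change c * (substAlgHom hasSubst_tt_sub_bracket_varX F * g) * q' = 1 at hy
  generalize substAlgHom hasSubst_tt_sub_bracket_varX F = u at *
  generalize substAlgHom hasSubst_tt_sub_bracket_varY F = u' at *
  have key : a * (u * c) = a' * (u' * c') := by
    linear_combination (-(a * u * c)) * hunit + (a' * u' * c') * hunit +
      (a' * u' * c' * g * G') * hy - (a * u * c * g * G') * hx + c * c' * u * u' * g * g * G' * hsym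
  linear_combination substAlgHom hasSubst_tt F * key

end Amplitudes

/-! ### Action of the derivation on shifted times -/

section MiwaShiftDerivation

variable {σ : Type}

theorem miwaDeriv_X_some {e : ℕ → σ} (he : Function.Injective e) (i : ℕ) :
    miwaDeriv e (X (some (e i))) = X none ^ i := by
  classical
  refine optionEquivLeft_ext fun n => ?_
  rw [← incl_X, coeff_miwaDeriv_incl, map_pow, optionEquivLeft_X_none, PowerSeries.coeff_X_pow]
  by_cases h : n = i
  · subst h; simp
  · rw [if_neg h, pderiv_X_of_ne fun h' => h (he h').symm]

theorem miwaDeriv_X_some_of_notMem {e : ℕ → σ} {s : σ} (hs : ∀ i, e i ≠ s) :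
    miwaDeriv e (X (some s)) = 0 := by
  refine optionEquivLeft_ext fun n => ?_
  rw [← incl_X, coeff_miwaDeriv_incl, pderiv_X_of_ne (hs n).symm, map_zero, map_zero]

theorem miwaDeriv_X_none (e : ℕ → σ) : miwaDeriv e (X none) = 1 := by
  refine optionEquivLeft_ext fun n => ?_
  rw [coeff_optionEquivLeft_miwaDeriv, optionEquivLeft_X_none, Finset.sum_eq_zero, add_zero,
    map_one]
  · cases n <;> simp [PowerSeries.coeff_X, PowerSeries.coeff_one]
  · intro i _
    rw [PowerSeries.coeff_X]
    split_ifs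
    · exact pderiv_one
    · exact map_zero _

theorem miwaDeriv_bracket (e : ℕ → σ) (i : ℕ) :
    miwaDeriv e (bracket (X none) i.succPNat) = X none ^ i := by
  rw [bracket, ← smul_eq_C_mul, Derivation.map_smul, Derivation.leibniz_pow, miwaDeriv_X_none,
    Nat.succPNat_coe, Nat.succ_sub_one, smul_eq_mul, mul_one, ← Nat.cast_smul_eq_nsmul ℂ, smul_smul,
    one_div_mul_cancel (by exact_mod_cast Nat.succ_ne_zero i), one_smul]

end MiwaShiftDerivation

/-- `t_{i+1}`, enumerated from `i = 0`. -/
def timeIdx (i : ℕ) : ℕ+ := i.succPNat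

theorem timeIdx_injective : Function.Injective timeIdx := Nat.succPNat_injective

theorem timeIdx_natPred (k : ℕ+) : timeIdx k.natPred = k := PNat.succPNat_natPred k

theorem miwaDeriv_shift (f : Fun ℕ+) : miwaDeriv timeIdx (shift (-1) f) = 0 := by
  refine miwaDeriv_algHom_eq_zero (finDet_shift _) (fun k => ?_) f
  obtain ⟨i, rfl⟩ : ∃ i, timeIdx i = k := ⟨_, timeIdx_natPred k⟩
  rw [shift_X, miwaArg_eq, map_neg, map_one, neg_one_mul, map_add, map_neg,
    miwaDeriv_X_some timeIdx_injective, timeIdx, miwaDeriv_bracket, add_neg_cancel]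

theorem miwaDeriv_shiftY (F : Fun (Option ℕ+)) :
    miwaDeriv (fun i => some (timeIdx i)) (shiftY F) = 0 := by
  refine miwaDeriv_algHom_eq_zero (finDet_evalOpt _ _) (fun o => ?_) F
  cases o with
  | none =>
    rw [evalOpt_X_none]
    exact miwaDeriv_X_some_of_notMem fun i => Option.some_ne_none _
  | some k =>
    obtain ⟨i, rfl⟩ : ∃ i, timeIdx i = k := ⟨_, timeIdx_natPred k⟩
    rw [evalOpt_X_some, Pi.sub_apply, map_sub]
    have h1 : miwaDeriv (fun i => some (timeIdx i)) (tt (timeIdx i)) = X none ^ i :=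
      miwaDeriv_X_some (e := fun i => some (timeIdx i))
        ((Option.some_injective _).comp timeIdx_injective) i
    have h2 : miwaDeriv (fun i => some (timeIdx i)) (bracket varY (timeIdx i)) = X none ^ i :=
      miwaDeriv_bracket _ i
    rw [h1, h2, sub_self]

theorem pderiv_incl {σ : Type} (s : σ) (f : Fun σ) :
    pderiv ℂ (some s) (incl σ f) = incl σ (pderiv ℂ s f) := by
  classical
  refine pderiv_algHom finDet_incl (fun a => ?_) f
  rw [incl_X]
  by_cases h : a = s
  · subst h; simp
  · rw [pderiv_X_of_ne h, pderiv_X_of_ne fun h' => h (Option.some_injective _ h'), map_zero]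

theorem pderiv_shift (k : ℕ+) (f : Fun ℕ+) :
    pderiv ℂ (some k) (shift (-1) f) = shift (-1) (pderiv ℂ k f) := by
  classical
  refine pderiv_algHom (finDet_shift _) (fun a => ?_) f
  have h0 : pderiv ℂ (some k) (C (-1) * bracket (X none) a : Fun (Option ℕ+)) = 0 := by
    rw [bracket, ← mul_assoc, ← map_mul, ← smul_eq_C_mul, Derivation.map_smul,
      Derivation.leibniz_pow, pderiv_X_of_ne (by simp), smul_zero, smul_zero, smul_zero]
  rw [shift_X, miwaArg_eq, map_add, h0, add_zero]
  by_cases h : a = k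
  · subst h; simp
  · rw [pderiv_X_of_ne h, pderiv_X_of_ne fun h' => h (Option.some_injective _ h'), map_zero]

/-! ### Integration of the cocycle -/

/-- A normalized amplitude with commuting Miwa shifts has a tau function. -/
theorem exists_shift_eq {A : Fun (Option ℕ+)}
    (h1 : PowerSeries.constantCoeff (optionEquivLeft ℕ+ ℂ A) = 1)
    (hA : incl (Option ℕ+) A * optionMap (shift (-1)) A = optionMap (incl ℕ+) A * shiftY A) :
    ∃ f : Fun ℕ+, constantCoeff f ≠ 0 ∧ shift (-1) f = A * incl ℕ+ f := by
  have hA1 : constantCoeff A = 1 := by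
    have := congrArg (coeff 0) h1
    rwa [← PowerSeries.coeff_zero_eq_constantCoeff_apply, coeff_coeff_optionEquivLeft,
      Finsupp.optionElim_zero, Finsupp.single_zero, coeff_zero_eq_constantCoeff_apply,
      coeff_zero_one] at this
  have hAu : IsUnit A := by rw [isUnit_iff_constantCoeff, hA1]; exact isUnit_one
  set N := miwaDeriv timeIdx
  -- `b` is the logarithmic derivative of `A` along `N`; its coefficients in `u` will form the
  -- 1-form.
  obtain ⟨b, hb⟩ : ∃ b, N A = b * A := by
    obtain ⟨u, rfl⟩ := hAu
    exact ⟨N u * ↑u⁻¹, by simp⟩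
  set N' := miwaDeriv (fun i => some (timeIdx i))
  have hM : ∀ F, N' (optionMap (shift (-1)) F) = optionMap (shift (-1)) (N F) :=
    miwaDeriv_optionMap fun i f => pderiv_shift _ f
  have hI : ∀ F, N' (optionMap (incl ℕ+) F) = optionMap (incl ℕ+) (N F) :=
    miwaDeriv_optionMap fun i f => pderiv_incl _ f
  -- Differentiate the cocycle condition along the analogue of `N` in `y`. The factor `A(t-[y],x)`
  -- is constant for it, and dividing by `A(t-[x],y)` leaves an equation linear in `b`.
  have hJ : N' (incl (Option ℕ+) A) + incl (Option ℕ+) A * optionMap (shift (-1)) b =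
      optionMap (incl ℕ+) b * incl (Option ℕ+) A := by
    have h2 := congrArg N' hA
    rw [Derivation.leibniz, Derivation.leibniz, hM, hI, miwaDeriv_shiftY, hb, map_mul, map_mul,
      smul_zero, zero_add] at h2
    simp only [smul_eq_mul] at h2
    refine (hAu.map (optionMap (shift (-1)))).mul_right_cancel ?_
    linear_combination h2 + optionMap (incl ℕ+) b * (-hA)
  have hJc : ∀ j, pderiv ℂ (some (timeIdx j)) A +
      A * shift (-1) (PowerSeries.coeff j (optionEquivLeft ℕ+ ℂ b)) =
        incl ℕ+ (PowerSeries.coeff j (optionEquivLeft ℕ+ ℂ b)) * A := by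
    intro j
    have h2 := congrArg (fun F => PowerSeries.coeff j (optionEquivLeft (Option ℕ+) ℂ F)) hJ
    simp only [map_add, map_mul, optionEquivLeft_incl, optionEquivLeft_optionMap,
      PowerSeries.coeff_C_mul, PowerSeries.coeff_mul_C, PowerSeries.coeff_map] at h2
    rw [coeff_miwaDeriv_incl] at h2
    exact h2
  -- Now differentiate the `y^j` coefficient along `N` in `x`: `b_j(t-[x])` is annihilated, and
  -- subtracting `b` times the undifferentiated equation leaves only derivatives of `b` and `b_j`.
  have hK : ∀ j, pderiv ℂ (some (timeIdx j)) b =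
      N (incl ℕ+ (PowerSeries.coeff j (optionEquivLeft ℕ+ ℂ b))) := by
    intro j
    have h2 := congrArg N (hJc j)
    rw [map_add, Derivation.leibniz, Derivation.leibniz, miwaDeriv_shift, ← pderiv_miwaDeriv, hb,
      Derivation.leibniz] at h2
    simp only [smul_eq_mul] at h2
    refine hAu.mul_right_cancel ?_
    linear_combination h2 - b * hJc j
  -- The `u^i` coefficient of the preceding relation.
  have hclosed : ∀ i j, pderiv ℂ (timeIdx j) (PowerSeries.coeff i (optionEquivLeft ℕ+ ℂ b)) =
      pderiv ℂ (timeIdx i) (PowerSeries.coeff j (optionEquivLeft ℕ+ ℂ b)) := by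
    intro i j
    rw [← coeff_optionEquivLeft_pderiv_some, hK, coeff_miwaDeriv_incl]
  -- The sign is chosen so that `N f = -b f`, making `A f` constant along `N`. Since `b_i` belongs
  -- to `t_{i+1}`, the index is the predecessor of `k`.
  obtain ⟨f, hf0, hf⟩ := exists_logPotential
    (fun k : ℕ+ => -PowerSeries.coeff k.natPred (optionEquivLeft ℕ+ ℂ b)) fun i j => by
      have := hclosed j.natPred i.natPred
      rw [timeIdx_natPred, timeIdx_natPred] at this
      rw [map_neg, map_neg, this]
  refine ⟨f, hf0, ?_⟩
  have hN : N (incl ℕ+ f) = -(b * incl ℕ+ f) := by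
    refine optionEquivLeft_ext fun n => ?_
    rw [coeff_miwaDeriv_incl, hf, map_neg, map_neg, map_mul, optionEquivLeft_incl,
      PowerSeries.coeff_mul_C, timeIdx, Nat.natPred_succPNat, neg_mul]
  rw [← sub_eq_zero]
  -- Both `f(t-[u])` and `A f` are annihilated by `N`, and both equal `f` at `u = 0`.
  refine eq_zero_of_miwaDeriv_eq_zero (e := timeIdx) ?_ ?_
  · change N _ = 0
    rw [map_sub, Derivation.leibniz, hb, hN, miwaDeriv_shift]
    simp only [smul_eq_mul]
    ring
  · rw [PowerSeries.coeff_zero_eq_constantCoeff_apply, map_sub, map_sub, map_mul, map_mul,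
      constantCoeff_optionEquivLeft_shift, h1, optionEquivLeft_incl, PowerSeries.constantCoeff_C,
      one_mul, sub_self]

/-- A first order recursion with invertible coefficients has a two-sided solution. -/
theorem exists_int_recursion {M : Type*} [CommMonoid M] (u : ℤ → Mˣ) (a : M) :
    ∃ f : ℤ → M, f 0 = a ∧ ∀ n, f (n + 1) = u n * f n := by
  let v : ℤ → Mˣ := fun n => match n with
    | Int.ofNat n => ∏ i ∈ Finset.range n, u i
    | Int.negSucc n => ∏ i ∈ Finset.range (n + 1), (u (-i - 1))⁻¹
  have hv : ∀ n, v (n + 1) = u n * v n := by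
    intro n
    match n with
    | Int.ofNat n =>
      change ∏ i ∈ Finset.range (n + 1), u i = u n * ∏ i ∈ Finset.range n, u i
      rw [Finset.prod_range_succ, mul_comm]
    | Int.negSucc 0 =>
      change ∏ i ∈ Finset.range 0, u i = u (-1) * ∏ i ∈ Finset.range (0 + 1), (u (-i - 1))⁻¹
      simp
    | Int.negSucc (n + 1) =>
      change ∏ i ∈ Finset.range (n + 1), (u (-i - 1))⁻¹ =
        u (Int.negSucc (n + 1)) * ∏ i ∈ Finset.range (n + 1 + 1), (u (-i - 1))⁻¹
      rw [Finset.prod_range_succ _ (n + 1),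
        show (-((n + 1 : ℕ) : ℤ) - 1) = Int.negSucc (n + 1) by rw [Int.negSucc_eq]; ring,
        mul_comm (u _), inv_mul_cancel_right]
  refine ⟨fun n => v n * a, ?_, fun n => ?_⟩
  · change ((∏ i ∈ Finset.range 0, u i : Mˣ) : M) * a = a
    simp
  · change (v (n + 1) : M) * a = u n * (v n * a)
    rw [hv, Units.val_mul, mul_assoc]

/-! ### Construction of the tau function -/

section TauFunction

variable {P Q : ℤ → PowerSeries (Fun ℕ+)}

theorem AmplitudeBilinear.exists_tau (h : AmplitudeBilinear P Q) :
    ∃ τ : ℤ → Fun ℕ+, (∀ n, constantCoeff (τ n) ≠ 0) ∧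
      (∀ n, τ (n + 1) = PowerSeries.constantCoeff (Q n) * τ n) ∧
      ∀ n, shift (-1) (τ n) =
        incl ℕ+ (PowerSeries.constantCoeff (Q n)) * amp P (n + 1) * incl ℕ+ (τ n) := by
  obtain ⟨f, hf0, hf⟩ := exists_shift_eq (A := incl ℕ+ (PowerSeries.constantCoeff (Q 0)) *
    amp P (0 + 1)) (by
      rw [map_mul, map_mul, optionEquivLeft_incl, PowerSeries.constantCoeff_C, optionEquivLeft_amp,
        mul_comm, h.leading_mul_leading]) (h.commutation 0 rfl)
  obtain ⟨τ, h0, hτ⟩ := exists_int_recursion (fun n => Units.mkOfMulEqOne _ _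
    ((mul_comm _ _).trans (h.leading_mul_leading n))) f
  have hτ' : ∀ n, τ (n + 1) = PowerSeries.constantCoeff (Q n) * τ n := hτ
  have hQ : ∀ n, constantCoeff (PowerSeries.constantCoeff (Q n)) ≠ 0 := fun n => by
    have := congrArg constantCoeff (h.leading_mul_leading n)
    rw [map_mul, map_one] at this
    exact right_ne_zero_of_mul (this ▸ one_ne_zero)
  have hshift : ∀ n, shift (-1) (PowerSeries.constantCoeff (P (n + 1))) *
      shift (-1) (PowerSeries.constantCoeff (Q n)) = 1 := fun n => by
    rw [← map_mul, h.leading_mul_leading, map_one]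
  -- Passing from `τ_n` to `τ_{n+1} = q_n τ_n` multiplies the shifted function by `q_n(t-[x])`; this
  -- identity shows that the shift equation keeps its form.
  have hamp : ∀ n, shift (-1) (PowerSeries.constantCoeff (Q n)) * amp P (n + 1) =
      incl ℕ+ (PowerSeries.constantCoeff (Q (n + 1))) * amp P (n + 1 + 1) := fun n => by
    rw [h.amp_eq (n + 1)]
    linear_combination (amp P (n + 1 + 1) * incl ℕ+ (PowerSeries.constantCoeff (Q (n + 1)))) *
      hshift n
  refine ⟨τ, fun n => ?_, hτ', fun n => ?_⟩
  · induction n using Int.induction_on with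
    | zero => rwa [h0]
    | succ n ih => rw [hτ', map_mul]; exact mul_ne_zero (hQ _) ih
    | pred n ih =>
      have := hτ' (-(n : ℤ) - 1)
      rw [sub_add_cancel] at this
      rw [this, map_mul] at ih
      exact right_ne_zero_of_mul ih
  · induction n using Int.induction_on with
    | zero => rw [h0, hf]
    | succ n ih =>
      rw [hτ', map_mul, map_mul, ih]
      linear_combination (incl ℕ+ (PowerSeries.constantCoeff (Q n)) * incl ℕ+ (τ n)) * hamp n
    | pred n ih =>
      have h2 := hτ' (-(n : ℤ) - 1)
      have h3 := hamp (-(n : ℤ) - 1)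
      have h4 := hshift (-(n : ℤ) - 1)
      rw [sub_add_cancel] at h2 h3 h4
      rw [h2, map_mul, map_mul] at ih
      rw [sub_add_cancel]
      generalize shift (-1) (PowerSeries.constantCoeff (Q (-(n : ℤ) - 1))) = a at *
      generalize shift (-1) (PowerSeries.constantCoeff (P (-(n : ℤ)))) = c at *
      generalize incl ℕ+ (PowerSeries.constantCoeff (Q (-(n : ℤ) - 1))) = q at *
      linear_combination c * ih - c * q * incl ℕ+ (τ (-(n : ℤ) - 1)) * h3 -
        shift (-1) (τ (-(n : ℤ) - 1)) * h4 + q * amp P (-(n : ℤ)) * incl ℕ+ (τ (-(n : ℤ) - 1)) * h4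

theorem miwa_neg_eq {τ : ℤ → Fun ℕ+}
    (h1 : ∀ n, τ (n + 1) = PowerSeries.constantCoeff (Q n) * τ n)
    (h2 : ∀ n, shift (-1) (τ n) =
      incl ℕ+ (PowerSeries.constantCoeff (Q n)) * amp P (n + 1) * incl ℕ+ (τ n)) (n : ℤ) :
    miwa (-1) (τ (n - 1)) = PowerSeries.C (τ n) * P n := by
  have h3 := h1 (n - 1)
  rw [sub_add_cancel] at h3
  rw [miwa_eq, h2, h3, map_mul, map_mul, optionEquivLeft_incl, optionEquivLeft_incl,
    optionEquivLeft_amp, sub_add_cancel, map_mul]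
  ring

/-- Since `Q_n(t-[x],x)` is inverse to `P_{n+1}(t,x)`, the shift equation gives `τ_n(t-[x])
Q_n(t-[x],x) = τ_{n+1}(t)`; replacing `t` by `t+[x]` finishes. -/
theorem AmplitudeBilinear.miwa_one_eq (h : AmplitudeBilinear P Q) {τ : ℤ → Fun ℕ+}
    (h1 : ∀ n, τ (n + 1) = PowerSeries.constantCoeff (Q n) * τ n)
    (h2 : ∀ n, shift (-1) (τ n) =
      incl ℕ+ (PowerSeries.constantCoeff (Q n)) * amp P (n + 1) * incl ℕ+ (τ n)) (n : ℤ) :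
    miwa 1 (τ (n + 1)) = PowerSeries.C (τ n) * Q n := by
  have h3 : fullShift (-1) (incl ℕ+ (τ n) * amp Q n) = incl ℕ+ (τ (n + 1)) := by
    rw [map_mul, fullShift_incl, h2, h1, map_mul]
    linear_combination incl ℕ+ (PowerSeries.constantCoeff (Q n)) * incl ℕ+ (τ n) *
      h.amp_mul_fullShift n
  have h4 := congrArg (fullShift 1) h3
  rw [fullShift_fullShift_neg, fullShift_incl] at h4
  rw [miwa_eq, ← h4, map_mul, optionEquivLeft_incl, optionEquivLeft_amp]

theorem AmplitudeBilinear.isTauFunction (h : AmplitudeBilinear P Q) {τ : ℤ → Fun ℕ+}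
    (hP : ∀ n, miwa (-1) (τ (n - 1)) = PowerSeries.C (τ n) * P n)
    (hQ : ∀ n, miwa 1 (τ (n + 1)) = PowerSeries.C (τ n) * Q n) : IsTauFunction τ := by
  intro n' n''
  change residue (n' - n'') _ _ + residue (n'' - n') _ _ = _
  have hsign : (-1 : ℂ) ^ (n' + n'') = (-1 : ℂ) ^ (n' - n'') := by
    rw [show n' + n'' = n' - n'' + 2 * n'' by ring, zpow_add₀ (by norm_num), zpow_mul]
    norm_num
  have hmap : ∀ (Φ : Fun ℕ+ →ₐ[ℂ] Fun (ℕ+ ⊕ ℕ+)) (c : Fun ℕ+) (A : PowerSeries (Fun ℕ+)),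
      PowerSeries.map Φ.toRingHom (PowerSeries.C c * A) =
        PowerSeries.C (Φ c) * PowerSeries.map Φ.toRingHom A := fun Φ c A => by
    rw [map_mul, PowerSeries.map_C]; rfl
  have hC : ∀ (a b : Fun (ℕ+ ⊕ ℕ+)) (A B : PowerSeries (Fun (ℕ+ ⊕ ℕ+))),
      PowerSeries.C a * A * (PowerSeries.C b * B) = PowerSeries.C (a * b) * (A * B) :=
    fun a b A B => by rw [map_mul, mul_mul_mul_comm]
  rw [hP, hQ, hP, hQ, hsign, ← h n' n'', hmap, hmap, hmap, hmap, hC, hC,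
    residue_C_mul lowWeight_expXi_sub, residue_C_mul lowWeight_expXi_neg_sub]
  ring

end TauFunction

end LargeBKP

end Lemmas

theorem mainTheorem3
    (wp wm : ℤ → ℕ → LargeBKP.Fun ℕ+)
    (Ψp Ψm : ℤ → LargeBKP.ZSeries ℕ+)
    (hΨp : ∀ n : ℤ, Ψp n = LargeBKP.plusForm n (PowerSeries.mk (wp n)))
    (hΨm : ∀ n : ℤ, Ψm n = LargeBKP.minusForm n (PowerSeries.mk (wm n)))
    (hbil : LargeBKP.WaveBilinear Ψp Ψm) :
    ∃ τ : ℤ → LargeBKP.Fun ℕ+,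
      LargeBKP.IsTauFunction τ ∧
      (∀ n : ℤ, MvPowerSeries.constantCoeff (τ n) ≠ 0) ∧
      (∀ n : ℤ, Ψp n = LargeBKP.plusForm n
        (PowerSeries.C (τ n)⁻¹ * LargeBKP.miwa (-1) (τ (n - 1)))) ∧
      (∀ n : ℤ, Ψm n = LargeBKP.minusForm n
        (PowerSeries.C (τ n)⁻¹ * LargeBKP.miwa 1 (τ (n + 1)))) := by
  have h := hbil.amplitudeBilinear hΨp hΨm
  obtain ⟨τ, h0, h1, h2⟩ := h.exists_tau
  have hP := LargeBKP.miwa_neg_eq h1 h2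
  have hQ := h.miwa_one_eq h1 h2
  refine ⟨τ, h.isTauFunction hP hQ, h0, fun n => ?_, fun n => ?_⟩
  · rw [hΨp, hP, ← mul_assoc, ← map_mul, MvPowerSeries.inv_mul_cancel _ (h0 n), map_one, one_mul]
  · rw [hΨm, hQ, ← mul_assoc, ← map_mul, MvPowerSeries.inv_mul_cancel _ (h0 n), map_one, one_mul]
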